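/- Let $1\le p,q\le\infty$. Let $W^1_p([0,1])$ be the space of absolutely continuous functions $f:[0,1]\to\mathbb R$ with $f'\in L_p([0,1])$, normed by $\|f\|_{W^1_p}=(\|f\|_p^p+\|f'\|_p^p)^{1/p}$ (by $\max(\|f\|_\infty,\|f'\|_\infty)$ if $p=\infty$), and let $F_p$ be its closed unit ball. For points $x_1,\dots,x_n\in[0,1]$ consider the information $N_n(f)=(f(x_1),\dots,f(x_n))$ and its radius for $L_q$-approximation, $$r(N_n)=\inf_{\phi:\mathbb R^n\to L_q([0,1])}\ \sup_{f\in F_p}\ \|f-\phi(N_n(f))\|_{L_q([0,1])},$$ where the infimum is over all mappings $\phi$. Let $r(N_n^*)=\inf_{x_1,\dots,x_n\in[0,1]}r(N_n)$ be the radius of optimal information, and let $\mathbb E[r(N_n)]$ be the expected radius when $x_1,\dots,x_n$ are independent and uniformly distributed in $[0,1]$. For sequences, $a_n\asymp b_n$ means that there is a constant $C\in(0,\infty)$, independent of $n$ (it may depend on $p$ and $q$), such that $a_n\le C\,b_n$ and $b_n\le C\,a_n$ for all $n$ under consideration. Then $r(N_n)$ is, up to modification on a null set, a measurable function of $(x_1,\dots,x_n)$,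 so that $\mathbb E[r(N_n)]$ is well defined, and the following hold. - If $p>q$, then $\mathbb E[r(N_n)]\asymp r(N_n^*)\asymp n^{-1}$ for $n\ge 1$. - If $p\le q$, then $\mathbb E[r(N_n)]\asymp r\big(N^*_{\lfloor n/\log n\rfloor}\big)\asymp\left(\frac{n}{\log n}\right)^{-1+1/p-1/q}$ for $n\ge 2$. -/

import Mathlib

open MeasureTheory
open scoped ENNReal NNReal

noncomputable section

namespace RandomInfo

/-- Lebesgue measure on `[0,1]`. -/
abbrev lebesgue01 : Measure ℝ := volume.restrict (Set.Icc (0 : ℝ) 1)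

/-- Membership in the Sobolev space `W^1_p([0,1])`, in terms of the continuous representative (the
one to which point evaluation refers): `f` is absolutely continuous on `[0,1]` and its derivative,
which exists a.e. and is the weak derivative of `f`, lies in `L_p([0,1])`.
Only the restriction of `f` to `[0,1]` matters. -/
def MemSobolev (p : ℝ≥0∞) (f : ℝ → ℝ) : Prop :=
  AbsolutelyContinuousOnInterval f 0 1 ∧ MemLp (deriv f) p lebesgue01

/-- The norm `(‖f‖_p^p + ‖f'‖_p^p)^(1/p)` of `W^1_p([0,1])`, with the usual modification
`max (‖f‖_∞, ‖f'‖_∞)` for `p = ∞`. -/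
def sobolevNorm (p : ℝ≥0∞) (f : ℝ → ℝ) : ℝ≥0∞ :=
  if p = ∞ then max (eLpNorm f ∞ lebesgue01) (eLpNorm (deriv f) ∞ lebesgue01)
  else (eLpNorm f p lebesgue01 ^ p.toReal + eLpNorm (deriv f) p lebesgue01 ^ p.toReal)
    ^ (1 / p.toReal)

/-- The input class: the unit ball of `W^1_p([0,1])`. -/
def unitBall (p : ℝ≥0∞) : Set (ℝ → ℝ) :=
  {f | MemSobolev p f ∧ sobolevNorm p f ≤ 1}

/-- The information mapping `N_n(f) = (f(x_1), …, f(x_n))`. -/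
def info {n : ℕ} (x : Fin n → unitInterval) (f : ℝ → ℝ) : Fin n → ℝ :=
  fun i => f (x i)

/-- The radius of information for `L_q`-approximation on the unit ball of `W^1_p([0,1])`: the worst
case error of the best algorithm `φ ∘ N_n`, with `φ : ℝⁿ → L_q([0,1])` an arbitrary mapping. -/
def radius (p q : ℝ≥0∞) {n : ℕ} (x : Fin n → unitInterval) : ℝ≥0∞ :=
  ⨅ φ : (Fin n → ℝ) → Lp ℝ q lebesgue01,
    ⨆ f ∈ unitBall p, eLpNorm (fun t => f t - φ (info x f) t) q lebesgue01

/-- The radius `r(N_n^*)` of optimal information given by `n` function values. -/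
def optimalRadius (p q : ℝ≥0∞) (n : ℕ) : ℝ≥0∞ :=
  ⨅ x : Fin n → unitInterval, radius p q x

/-- The expected radius `E[r(N_n)]` for `n` independent points with the uniform distribution on
`[0,1]`; here `volume` on `Fin n → unitInterval` is the `n`-fold product of Lebesgue measure
on `[0,1]`, that is, the joint law of the points. -/
def expectedRadius (p q : ℝ≥0∞) (n : ℕ) : ℝ≥0∞ :=
  ∫⁻ x : Fin n → unitInterval, radius p q x

/-- `a_n ≍ b_n`, for the indices `n ≥ n₀`. -/
def Asymp (n₀ : ℕ) (a b : ℕ → ℝ≥0∞) : Prop :=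
  ∃ C : ℝ≥0, 0 < C ∧ ∀ n : ℕ, n₀ ≤ n → a n ≤ C * b n ∧ b n ≤ C * a n

end RandomInfo

end

/-!
If `f` in the unit ball vanishes at all nodes, then `f` and `-f` yield the same information, so
the radius is at least `‖f‖_q`. Conversely, let two functions of the unit ball have the same
information and let `h` be their difference. Every point of `[0,1]` lies in a gap between
consecutive nodes, at one end of which `h` vanishes (the two outermost gaps have a node at one end
only); hence `|h|` is at most the integral of `|h'|` over the gap, and Hölder's inequality bounds
the error by the lengths of the gaps.

For `p ≤ q` only the longest gap matters: the radius is of order `δ ^ (1 - 1/p + 1/q)` where `δ`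
is its length, the lower bound coming from a tent function supported in that gap. Cut `[0,1]` into
`m` cells. With `m` of order `n / log n` small, no cell is missed by the nodes except with
probability at most `m exp (-n/m)`, by a union bound; with `m` of the same order but large, the
events that a cell is missed are negatively correlated and the sum of their probabilities is at
least `1`, so that some cell is missed with probability at least `1/2`, by the second moment
method.

For `q < p` the radius is bounded by a power mean of the lengths of the gap around `t`, averaged
over `t`. This length has exponential tails on the scale `1/n`, so all its moments are of the
order of the corresponding power of `1/n`. The distance to the nearest node gives the lower bound.

The radius is measurable because a small displacement of distinct interior nodes extends to a
bi-Lipschitz change of variables of `[0,1]` with constants close to `1`, under which the radius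
changes by a factor close to `1`: the radius is continuous off a null set.
-/

namespace RandomInfo

open Set Filter Topology

section UnitBall

instance : IsProbabilityMeasure lebesgue01 := ⟨by simp⟩

variable {p q : ℝ≥0∞} {f g : ℝ → ℝ}

lemma MemSobolev.continuousOn (hf : MemSobolev p f) : ContinuousOn f (Icc 0 1) := by
  simpa only [uIcc_of_le (zero_le_one' ℝ)] using hf.1.continuousOn

lemma MemSobolev.aestronglyMeasurable (hf : MemSobolev p f) :
    AEStronglyMeasurable f lebesgue01 :=
  hf.continuousOn.aestronglyMeasurable measurableSet_Icc

lemma MemSobolev.memLp (hf : MemSobolev p f) (q : ℝ≥0∞) : MemLp f q lebesgue01 := by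
  obtain ⟨C, hC⟩ := isCompact_Icc.exists_bound_of_continuousOn hf.continuousOn
  exact MemLp.of_bound hf.aestronglyMeasurable C
    ((ae_restrict_mem measurableSet_Icc).mono fun t ht => hC t ht)

lemma MemSobolev.ae_differentiableAt (hf : MemSobolev p f) :
    ∀ᵐ t ∂lebesgue01, DifferentiableAt ℝ f t := by
  rw [ae_restrict_iff' measurableSet_Icc]
  simpa only [uIcc_of_le (zero_le_one' ℝ)] using hf.1.ae_differentiableAt

lemma eLpNorm_deriv_le_sobolevNorm (hp : 1 ≤ p) :
    eLpNorm (deriv f) p lebesgue01 ≤ sobolevNorm p f := by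
  unfold sobolevNorm
  split_ifs with hp'
  · rw [hp']
    exact le_max_right _ _
  · rw [one_div, ENNReal.le_rpow_inv_iff (ENNReal.toReal_pos (by positivity) hp')]
    exact le_add_self

lemma sobolevNorm_le_add (hp : 1 ≤ p) :
    sobolevNorm p f ≤ eLpNorm f p lebesgue01 + eLpNorm (deriv f) p lebesgue01 := by
  unfold sobolevNorm
  split_ifs with hp'
  · rw [hp']
    exact max_le le_self_add le_add_self
  · exact ENNReal.rpow_add_rpow_le_add _ _ (by simpa using ENNReal.toReal_mono hp' hp)

lemma sobolevNorm_le_mul (hp : 1 ≤ p) {c : ℝ≥0∞}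
    (hval : eLpNorm f p lebesgue01 ≤ c * eLpNorm g p lebesgue01)
    (hderiv : eLpNorm (deriv f) p lebesgue01 ≤ c * eLpNorm (deriv g) p lebesgue01) :
    sobolevNorm p f ≤ c * sobolevNorm p g := by
  unfold sobolevNorm
  split_ifs with hp'
  · rw [hp'] at hval hderiv
    exact max_le (hval.trans (by gcongr; exact le_max_left _ _))
      (hderiv.trans (by gcongr; exact le_max_right _ _))
  · have hp0 : 0 < p.toReal := ENNReal.toReal_pos (by positivity) hp'
    calc _ ≤ ((c * eLpNorm g p lebesgue01) ^ p.toReal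
          + (c * eLpNorm (deriv g) p lebesgue01) ^ p.toReal) ^ (1 / p.toReal) := by gcongr
      _ = _ := by
        rw [ENNReal.mul_rpow_of_nonneg _ _ hp0.le, ENNReal.mul_rpow_of_nonneg _ _ hp0.le,
          ← mul_add, ENNReal.mul_rpow_of_nonneg _ _ (by positivity), ← ENNReal.rpow_mul,
          mul_one_div_cancel hp0.ne', ENNReal.rpow_one]

lemma neg_mem_unitBall (hf : f ∈ unitBall p) : -f ∈ unitBall p := by
  have hderiv : deriv (-f) = -deriv f := by
    ext t
    exact deriv.neg
  refine ⟨⟨hf.1.1.neg, by rw [hderiv]; exact hf.1.2.neg⟩, ?_⟩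
  simpa only [sobolevNorm, hderiv, eLpNorm_neg] using hf.2

lemma inv_smul_mem_unitBall (hp : 1 ≤ p) {k : ℝ} (hk : k ≠ 0)
    (hac : AbsolutelyContinuousOnInterval f 0 1) (hg : g ∈ unitBall p)
    (hval : eLpNorm f p lebesgue01 ≤ ‖k‖ₑ * eLpNorm g p lebesgue01)
    (hderiv : eLpNorm (deriv f) p lebesgue01 ≤ ‖k‖ₑ * eLpNorm (deriv g) p lebesgue01) :
    k⁻¹ • f ∈ unitBall p := by
  have hinv (a : ℝ≥0∞) : ‖k⁻¹‖ₑ * (‖k‖ₑ * a) = 1 * a := by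
    rw [← mul_assoc, ← enorm_mul, inv_mul_cancel₀ hk, enorm_one]
  have hderiv_smul : deriv (k⁻¹ • f) = k⁻¹ • deriv f := by
    ext t
    rw [deriv_const_smul_field, Pi.smul_apply]
  have hderiv_lt_top : eLpNorm (deriv f) p lebesgue01 < ⊤ :=
    hderiv.trans_lt (ENNReal.mul_lt_top enorm_lt_top hg.1.2.2)
  refine ⟨⟨hac.const_smul k⁻¹, ?_⟩, ?_⟩
  · rw [hderiv_smul]
    exact MemLp.const_smul ⟨(measurable_deriv f).aestronglyMeasurable, hderiv_lt_top⟩ _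
  · refine (sobolevNorm_le_mul hp (c := 1) (g := g) ?_ ?_).trans (by rw [one_mul]; exact hg.2)
    · rw [eLpNorm_const_smul, ← hinv]
      gcongr
    · rw [hderiv_smul, eLpNorm_const_smul, ← hinv]
      gcongr

lemma mem_unitBall_of_lipschitzWith (hp : 1 ≤ p) {K : ℝ≥0} (hf : LipschitzWith K f)
    (hval : eLpNorm f p lebesgue01 ≤ 2⁻¹) (hderiv : eLpNorm (deriv f) p lebesgue01 ≤ 2⁻¹) :
    f ∈ unitBall p := by
  refine ⟨⟨hf.lipschitzOnWith.absolutelyContinuousOnInterval,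
    (measurable_deriv f).aestronglyMeasurable, hderiv.trans_lt (by simp)⟩, ?_⟩
  exact (sobolevNorm_le_add hp).trans
    ((add_le_add hval hderiv).trans_eq ENNReal.inv_two_add_inv_two)

lemma eLpNorm_deriv_sub_le_two (hp : 1 ≤ p) (hf : f ∈ unitBall p) (hg : g ∈ unitBall p) :
    eLpNorm (deriv f - deriv g) p lebesgue01 ≤ 2 := by
  calc eLpNorm (deriv f - deriv g) p lebesgue01
      ≤ eLpNorm (deriv f) p lebesgue01 + eLpNorm (deriv g) p lebesgue01 :=
        eLpNorm_sub_le hf.1.2.1 hg.1.2.1 hp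
    _ ≤ 1 + 1 := add_le_add ((eLpNorm_deriv_le_sobolevNorm hp).trans hf.2)
        ((eLpNorm_deriv_le_sobolevNorm hp).trans hg.2)
    _ = 2 := one_add_one_eq_two

end UnitBall

section Radius

variable {p q : ℝ≥0∞} {n : ℕ} {x : Fin n → unitInterval}

lemma radius_le_of_forall {B : ℝ≥0∞}
    (hB : ∀ f ∈ unitBall p, ∀ g ∈ unitBall p, info x f = info x g →
      eLpNorm (f - g) q lebesgue01 ≤ B) : radius p q x ≤ B := by
  classical
  refine iInf_le_of_le (fun y => if h : ∃ g ∈ unitBall p, info x g = y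
    then (h.choose_spec.1.1.memLp q).toLp else 0) (iSup₂_le fun f hf => ?_)
  have hinterp : ∃ g ∈ unitBall p, info x g = info x f := ⟨f, hf, rfl⟩
  obtain ⟨hgball, hgf⟩ := hinterp.choose_spec
  simp only [dif_pos hinterp]
  refine (eLpNorm_congr_ae ?_).trans_le (hB f hf _ hgball hgf.symm)
  filter_upwards [(hgball.1.memLp q).coeFn_toLp] with t ht
  rw [ht, Pi.sub_apply]

-- The information does not separate `f` from `-f`, and their distance is `2 ‖f‖_q`.
lemma eLpNorm_le_radius (hq : 1 ≤ q) {f : ℝ → ℝ} (hf : f ∈ unitBall p)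
    (hfx : ∀ i, f (x i) = 0) : eLpNorm f q lebesgue01 ≤ radius p q x := by
  refine le_iInf fun φ => ?_
  set B := ⨆ f ∈ unitBall p, eLpNorm (fun t => f t - φ (info x f) t) q lebesgue01
  have hinfo : info x f = 0 := funext hfx
  have hinfo_neg : info x (-f) = 0 := by
    ext i
    simp [info, hfx]
  set g : ℝ → ℝ := ⇑(φ 0)
  have hpos : eLpNorm (f - g) q lebesgue01 ≤ B := le_iSup₂_of_le f hf (by rw [hinfo]; rfl)
  have hneg : eLpNorm (-f - g) q lebesgue01 ≤ B :=
    le_iSup₂_of_le (-f) (neg_mem_unitBall hf) (by rw [hinfo_neg]; rfl)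
  have hfm := hf.1.aestronglyMeasurable
  have hgm : AEStronglyMeasurable g lebesgue01 := Lp.aestronglyMeasurable _
  have htwo : 2 * eLpNorm f q lebesgue01 ≤ 2 * B :=
    calc 2 * eLpNorm f q lebesgue01 = eLpNorm ((2 : ℝ) • f) q lebesgue01 := by
          rw [eLpNorm_const_smul, Real.enorm_of_nonneg zero_le_two, ENNReal.ofReal_ofNat]
      _ = eLpNorm ((f - g) - (-f - g)) q lebesgue01 := by
          rw [sub_sub_sub_cancel_right, sub_neg_eq_add, ← two_smul ℝ f]
      _ ≤ B + B := (eLpNorm_sub_le (hfm.sub hgm) (hfm.neg.sub hgm) hq).trans (add_le_add hpos hneg)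
      _ = 2 * B := (two_mul B).symm
  exact (ENNReal.mul_le_mul_iff_right two_ne_zero ENNReal.ofNat_ne_top).1 htwo

end Radius

section Tent

/-- The hat function of height and half-width `w` centred at `c`. It serves both to move single
nodes and as a fooling function. -/
def tent (c w t : ℝ) : ℝ := max 0 (w - |t - c|)

variable {c w t : ℝ}

lemma tent_nonneg : 0 ≤ tent c w t := le_max_left _ _

lemma tent_le (hw : 0 ≤ w) : tent c w t ≤ w :=
  max_le hw (sub_le_self _ (abs_nonneg _))

lemma tent_self (hw : 0 ≤ w) : tent c w c = w := by
  simp [tent, hw]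

lemma tent_of_le_abs_sub (h : w ≤ |t - c|) : tent c w t = 0 :=
  max_eq_left (sub_nonpos.2 h)

lemma lipschitzWith_tent (c w : ℝ) : LipschitzWith 1 (tent c w) :=
  ((LipschitzWith.const w).sub ((lipschitzWith_one_norm (E := ℝ)).comp
    (LipschitzWith.id.sub (LipschitzWith.const c)))).const_max 0 |>.weaken (by simp)

end Tent

section Composition

lemma eLpNorm_comp_le_of_map_le {α E : Type*} [MeasurableSpace α] [NormedAddCommGroup E]
    {μ : Measure α} {T : α → α} {c : ℝ≥0∞} (hc : 1 ≤ c) (hT : AEMeasurable T μ)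
    (hmap : μ.map T ≤ c • μ) {p : ℝ≥0∞} (hp : 1 ≤ p) {g : α → E}
    (hg : AEStronglyMeasurable g μ) : eLpNorm (g ∘ T) p μ ≤ c * eLpNorm g p μ := by
  have hinv : (1 / p).toReal ≤ 1 := by
    simpa using ENNReal.toReal_mono ENNReal.one_ne_top (ENNReal.inv_le_one.2 hp)
  calc eLpNorm (g ∘ T) p μ = eLpNorm g p (μ.map T) :=
        (eLpNorm_map_measure ((hg.smul_measure c).mono_measure hmap) hT).symm
    _ ≤ eLpNorm g p (c • μ) := eLpNorm_mono_measure g hmap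
    _ = c ^ (1 / p).toReal * eLpNorm g p μ :=
        eLpNorm_smul_measure_of_ne_zero (zero_lt_one.trans_le hc).ne' g p μ
    _ ≤ c ^ (1 : ℝ) * eLpNorm g p μ := by gcongr
    _ = c * eLpNorm g p μ := by rw [ENNReal.rpow_one]

lemma image_uIoc (T : ℝ ≃o ℝ) (a b : ℝ) : T '' uIoc a b = uIoc (T a) (T b) := by
  simp only [uIoc, T.image_Ioc, T.monotone.map_min, T.monotone.map_max]

lemma absolutelyContinuousOnInterval_comp {T : ℝ ≃o ℝ} {c : ℝ≥0} (hT : LipschitzWith c T)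
    {f : ℝ → ℝ} {a b : ℝ} (hf : AbsolutelyContinuousOnInterval f (T a) (T b)) :
    AbsolutelyContinuousOnInterval (f ∘ T) a b := by
  rw [absolutelyContinuousOnInterval_iff] at hf ⊢
  intro ε hε
  obtain ⟨δ, hδ, hfδ⟩ := hf ε hε
  refine ⟨δ / (c + 1), by positivity, fun E hE hlength => ?_⟩
  refine hfδ (E.1, fun i => (T (E.2 i).1, T (E.2 i).2)) ⟨fun i hi => ?_, fun i hi j hj hij => ?_⟩ ?_
  · have hmem : ∀ t ∈ uIcc a b, T t ∈ uIcc (T a) (T b) := fun t ht =>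
      mem_uIcc.2 ((mem_uIcc.1 ht).imp (And.imp (T.monotone ·) (T.monotone ·))
        (And.imp (T.monotone ·) (T.monotone ·)))
    exact ⟨hmem _ (hE.1 i hi).1, hmem _ (hE.1 i hi).2⟩
  · simpa only [Function.onFun, image_uIoc] using
      (disjoint_image_iff T.injective).2 (hE.2 hi hj hij)
  · calc ∑ i ∈ Finset.range E.1, dist (T (E.2 i).1) (T (E.2 i).2)
        ≤ ∑ i ∈ Finset.range E.1, c * dist (E.2 i).1 (E.2 i).2 :=
          Finset.sum_le_sum fun i _ => hT.dist_le_mul _ _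
      _ = c * ∑ i ∈ Finset.range E.1, dist (E.2 i).1 (E.2 i).2 := (Finset.mul_sum ..).symm
      _ ≤ c * (δ / (c + 1)) := by gcongr
      _ < δ := by
        rw [mul_div_assoc', div_lt_iff₀ (by positivity)]
        linarith

end Composition

/-- `T` is a bi-Lipschitz reparametrization of `[0,1]` with constant `c`, fixing the end points and
extended to a monotone bijection of `ℝ`. Composition with `T` moves the nodes and changes norms by
at most a power of `c`. -/
structure IsReparam (T : ℝ ≃o ℝ) (c : ℝ≥0) : Prop where
  lipschitz : LipschitzWith c T
  lipschitz_symm : LipschitzWith c T.symm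
  map_zero : T 0 = 0
  map_one : T 1 = 1

namespace IsReparam

variable {T : ℝ ≃o ℝ} {c : ℝ≥0} {p : ℝ≥0∞} {f g : ℝ → ℝ}

lemma symm (hT : IsReparam T c) : IsReparam T.symm c where
  lipschitz := hT.lipschitz_symm
  lipschitz_symm := hT.lipschitz
  map_zero := T.symm_apply_eq.2 hT.map_zero.symm
  map_one := T.symm_apply_eq.2 hT.map_one.symm

lemma one_le (hT : IsReparam T c) : 1 ≤ c := by
  simpa [hT.map_zero, hT.map_one] using hT.lipschitz.nndist_le 0 1

lemma measurable (hT : IsReparam T c) : Measurable T := hT.lipschitz.continuous.measurable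

lemma map_volume_le (hT : IsReparam T c) : volume.map T ≤ (c : ℝ≥0∞) • volume := by
  refine Measure.le_iff.2 fun s hs => ?_
  have himage := hT.lipschitz_symm.hausdorffMeasure_image_le zero_le_one s
  rw [hausdorffMeasure_real, ENNReal.rpow_one, T.symm.image_eq_preimage_symm] at himage
  rwa [Measure.map_apply hT.measurable hs, Measure.smul_apply, smul_eq_mul]

lemma map_lebesgue01_le (hT : IsReparam T c) :
    lebesgue01.map T ≤ (c : ℝ≥0∞) • lebesgue01 := by
  have hIcc : T ⁻¹' Icc 0 1 = Icc 0 1 := by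
    rw [T.preimage_Icc, hT.symm.map_zero, hT.symm.map_one]
  calc lebesgue01.map T = (volume.map T).restrict (Icc 0 1) := by
        rw [Measure.restrict_map hT.measurable measurableSet_Icc, hIcc]
    _ ≤ ((c : ℝ≥0∞) • volume).restrict (Icc 0 1) :=
        Measure.restrict_mono_measure hT.map_volume_le _
    _ = (c : ℝ≥0∞) • lebesgue01 := Measure.restrict_smul _ _ _

lemma quasiMeasurePreserving (hT : IsReparam T c) :
    Measure.QuasiMeasurePreserving T lebesgue01 lebesgue01 :=
  ⟨hT.measurable,
    hT.map_lebesgue01_le.absolutelyContinuous.trans Measure.smul_absolutelyContinuous⟩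

lemma eLpNorm_comp_le (hT : IsReparam T c) (hp : 1 ≤ p) (hg : AEStronglyMeasurable g lebesgue01) :
    eLpNorm (g ∘ T) p lebesgue01 ≤ c * eLpNorm g p lebesgue01 :=
  eLpNorm_comp_le_of_map_le (mod_cast hT.one_le) hT.measurable.aemeasurable hT.map_lebesgue01_le
    hp hg

lemma memLp_comp (hT : IsReparam T c) (hp : 1 ≤ p) (hg : MemLp g p lebesgue01) :
    MemLp (g ∘ T) p lebesgue01 :=
  ⟨hg.1.comp_quasiMeasurePreserving hT.quasiMeasurePreserving,
    (hT.eLpNorm_comp_le hp hg.1).trans_lt (ENNReal.mul_lt_top ENNReal.coe_lt_top hg.2)⟩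

lemma ae_norm_deriv_comp_le (hT : IsReparam T c) (hf : MemSobolev p f) :
    ∀ᵐ t ∂lebesgue01, ‖deriv (f ∘ T) t‖ ≤ c * ‖deriv f (T t)‖ := by
  filter_upwards [hT.quasiMeasurePreserving.ae hf.ae_differentiableAt,
    ae_restrict_of_ae hT.lipschitz.ae_differentiableAt_real] with t hf_t hT_t
  rw [deriv_comp t hf_t hT_t, norm_mul, mul_comm]
  gcongr
  exact norm_deriv_le_of_lipschitz hT.lipschitz

lemma eLpNorm_deriv_comp_le (hT : IsReparam T c) (hp : 1 ≤ p) (hf : MemSobolev p f) :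
    eLpNorm (deriv (f ∘ T)) p lebesgue01 ≤ c ^ 2 * eLpNorm (deriv f) p lebesgue01 :=
  calc eLpNorm (deriv (f ∘ T)) p lebesgue01
      ≤ ENNReal.ofReal c * eLpNorm (deriv f ∘ T) p lebesgue01 :=
        eLpNorm_le_mul_eLpNorm_of_ae_le_mul (hT.ae_norm_deriv_comp_le hf) p
    _ = c * eLpNorm (deriv f ∘ T) p lebesgue01 := by rw [ENNReal.ofReal_coe_nnreal]
    _ ≤ c * (c * eLpNorm (deriv f) p lebesgue01) := by
        gcongr
        exact hT.eLpNorm_comp_le hp hf.2.1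
    _ = c ^ 2 * eLpNorm (deriv f) p lebesgue01 := by rw [← mul_assoc, pow_two]

lemma inv_smul_comp_mem_unitBall (hT : IsReparam T c) (hp : 1 ≤ p) (hf : f ∈ unitBall p) :
    ((c : ℝ) ^ 2)⁻¹ • (f ∘ T) ∈ unitBall p := by
  have hc : (c : ℝ) ≠ 0 := (zero_lt_one.trans_le (NNReal.one_le_coe.2 hT.one_le)).ne'
  have henorm : ‖(c : ℝ) ^ 2‖ₑ = (c : ℝ≥0∞) ^ 2 := by simp [enorm_pow]
  have hac : AbsolutelyContinuousOnInterval f (T 0) (T 1) := by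
    rw [hT.map_zero, hT.map_one]
    exact hf.1.1
  refine inv_smul_mem_unitBall hp (pow_ne_zero 2 hc)
    (absolutelyContinuousOnInterval_comp hT.lipschitz hac) hf ?_ ?_ <;> rw [henorm]
  · refine (hT.eLpNorm_comp_le hp hf.1.aestronglyMeasurable).trans ?_
    gcongr
    exact le_self_pow₀ (mod_cast hT.one_le) two_ne_zero
  · exact hT.eLpNorm_deriv_comp_le hp hf.1

-- An algorithm `φ` for the nodes `x` yields the algorithm `y ↦ c² φ(y / c²) ∘ T⁻¹` for the nodes
-- `T x`; its error for `f` is `c²` times the error of `φ` for `(f ∘ T) / c²`, composed with `T⁻¹`.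
lemma radius_le (hT : IsReparam T c) (hp : 1 ≤ p) {q : ℝ≥0∞} (hq : 1 ≤ q) {n : ℕ}
    {x x' : Fin n → unitInterval} (hx : ∀ i, T (x i) = x' i) :
    radius p q x' ≤ c ^ 3 * radius p q x := by
  have hc : (c : ℝ≥0∞) ≠ 0 := mod_cast (zero_lt_one.trans_le hT.one_le).ne'
  set k : ℝ := (c : ℝ) ^ 2
  have hk : k ≠ 0 := pow_ne_zero 2 (mod_cast hc)
  unfold radius
  rw [ENNReal.mul_iInf_of_ne (pow_ne_zero 3 hc) (ENNReal.pow_ne_top ENNReal.coe_ne_top)]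
  refine le_iInf fun φ => ?_
  have hmem (y : Fin n → ℝ) : MemLp (k • (φ y ∘ T.symm)) q lebesgue01 :=
    (hT.symm.memLp_comp hq (Lp.memLp (φ y))).const_smul k
  refine iInf_le_of_le (fun y => (hmem (k⁻¹ • y)).toLp) (iSup₂_le fun f hf => ?_)
  set g : ℝ → ℝ := k⁻¹ • (f ∘ T) with hg
  have hgball : g ∈ unitBall p := hT.inv_smul_comp_mem_unitBall hp hf
  have hinfo : k⁻¹ • info x' f = info x g := by
    ext i
    simp [info, hg, hx]
  set d : ℝ → ℝ := fun t => g t - φ (info x g) t with hd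
  have herror : (fun t => f t - (hmem (k⁻¹ • info x' f)).toLp _ t)
      =ᵐ[lebesgue01] k • (d ∘ T.symm) := by
    filter_upwards [(hmem (k⁻¹ • info x' f)).coeFn_toLp] with t ht
    rw [ht, hinfo]
    simp only [hd, hg, Pi.smul_apply, Function.comp_apply, T.apply_symm_apply, smul_eq_mul]
    field_simp
  calc eLpNorm (fun t => f t - (hmem (k⁻¹ • info x' f)).toLp _ t) q lebesgue01
      = c ^ 2 * eLpNorm (d ∘ T.symm) q lebesgue01 := by
        rw [eLpNorm_congr_ae herror, eLpNorm_const_smul]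
        simp [k, enorm_pow]
    _ ≤ c ^ 2 * (c * eLpNorm d q lebesgue01) := by
        gcongr
        exact hT.symm.eLpNorm_comp_le hq
          (hgball.1.aestronglyMeasurable.sub (Lp.aestronglyMeasurable _))
    _ = c ^ 3 * eLpNorm d q lebesgue01 := by ring
    _ ≤ c ^ 3 * ⨆ f ∈ unitBall p, eLpNorm (fun t => f t - φ (info x f) t) q lebesgue01 := by
        gcongr
        exact le_iSup₂_of_le g hgball le_rfl

end IsReparam

section Measurability

lemma exists_orderIso_add {φ : ℝ → ℝ} {K : ℝ≥0} (hφ : LipschitzWith K φ) (hK : K < 1) :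
    ∃ T : ℝ ≃o ℝ, (∀ t, T t = t + φ t) ∧ LipschitzWith (1 - K)⁻¹ T ∧
      LipschitzWith (1 - K)⁻¹ T.symm := by
  have hmono : StrictMono fun t => t + φ t := fun s t hst => by
    have hdist := hφ.dist_le_mul s t
    rw [Real.dist_eq, Real.dist_eq, abs_sub_comm s, abs_of_pos (sub_pos.2 hst)] at hdist
    have hlt : K * (t - s) < t - s := mul_lt_of_lt_one_left (sub_pos.2 hst) hK
    simp only
    linarith [le_abs_self (φ s - φ t)]
  have hsurj : Function.Surjective fun t => t + φ t := fun y => by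
    have hcontr : ContractingWith K fun t => y - φ t :=
      ⟨hK, by simpa using (LipschitzWith.const y).sub hφ⟩
    exact ⟨hcontr.fixedPoint, by linarith [hcontr.fixedPoint_isFixedPt.eq]⟩
  have hanti : AntilipschitzWith (1 - K)⁻¹ fun t => t + φ t := by
    simpa using AntilipschitzWith.id.add_lipschitzWith hφ (by simpa using hK)
  have hle : 1 + K ≤ (1 - K)⁻¹ := by
    rw [NNReal.le_inv_iff_mul_le (tsub_pos_of_lt hK).ne', ← NNReal.coe_le_coe]
    push_cast [hK.le]
    nlinarith [K.coe_nonneg]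
  let T := hmono.orderIsoOfSurjective _ hsurj
  exact ⟨T, fun _ => rfl, (LipschitzWith.id.add hφ).weaken hle,
    hanti.to_rightInverse T.apply_symm_apply⟩

/-- The configurations of distinct nodes in the open interval `(0,1)`; nodes of such a
configuration can be moved slightly by a reparametrization. -/
def regularNodes (n : ℕ) : Set (Fin n → unitInterval) :=
  {x | Function.Injective x ∧ ∀ i, (x i : ℝ) ∈ Ioo 0 1}

variable {n : ℕ} {x : Fin n → unitInterval}

lemma isOpen_regularNodes (n : ℕ) : IsOpen (regularNodes n) := by
  have hinter : regularNodes n = (⋂ i, ⋂ j, ⋂ (_ : i ≠ j), {x | x i ≠ x j}) ∩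
      ⋂ i, (fun x : Fin n → unitInterval => (x i : ℝ)) ⁻¹' Ioo 0 1 := by
    ext x
    simp only [regularNodes, Function.Injective, mem_ofPred_eq, mem_inter_iff, mem_iInter,
      mem_preimage, not_imp_not, ne_eq]
  rw [hinter]
  refine .inter (isOpen_iInter_of_finite fun i => isOpen_iInter_of_finite fun j =>
    isOpen_iInter_of_finite fun _ => isOpen_ne_fun (by fun_prop) (by fun_prop))
    (isOpen_iInter_of_finite fun i => isOpen_Ioo.preimage (by fun_prop))

lemma exists_separation (hx : x ∈ regularNodes n) :
    ∃ w > 0, (∀ i, (x i : ℝ) ∈ Icc w (1 - w)) ∧ ∀ i j, i ≠ j → w ≤ |(x j : ℝ) - x i| := by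
  have hsmall {a : ℝ} (ha : 0 < a) : ∀ᶠ w in 𝓝[>] (0 : ℝ), w ≤ a := by
    filter_upwards [Ioc_mem_nhdsGT ha] with w hw using hw.2
  have hends : ∀ᶠ w in 𝓝[>] (0 : ℝ), ∀ i, (x i : ℝ) ∈ Icc w (1 - w) := by
    refine eventually_all.2 fun i => ?_
    filter_upwards [hsmall (hx.2 i).1, hsmall (sub_pos.2 (hx.2 i).2)] with w h0 h1
    exact ⟨h0, by linarith⟩
  have hpairs : ∀ᶠ w in 𝓝[>] (0 : ℝ), ∀ i j, i ≠ j → w ≤ |(x j : ℝ) - x i| := by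
    refine eventually_all.2 fun i => eventually_all.2 fun j => eventually_imp_distrib_left.2
      fun hij => hsmall (abs_pos.2 (sub_ne_zero.2 fun h => hij (hx.1 (Subtype.ext h)).symm))
  obtain ⟨w, hw, hends_w, hpairs_w⟩ :=
    (eventually_mem_nhdsWithin.and (hends.and hpairs)).exists
  exact ⟨w, hw, hends_w, hpairs_w⟩

-- `T` adds to the identity, for every node, a hat function that moves this node only.
lemma eventually_exists_isReparam (hx : x ∈ regularNodes n) {c : ℝ≥0} (hc : 1 < c) :
    ∀ᶠ x' in 𝓝 x, ∃ T : ℝ ≃o ℝ, IsReparam T c ∧ ∀ i, T (x i) = x' i := by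
  obtain ⟨w, hw, hends, hpairs⟩ := exists_separation hx
  have hcont : Tendsto (fun x' : Fin n → unitInterval => ∑ i, ‖((x' i : ℝ) - x i) / w‖₊)
      (𝓝 x) (𝓝 0) := by
    have : Continuous fun x' : Fin n → unitInterval => ∑ i, ‖((x' i : ℝ) - x i) / w‖₊ := by
      fun_prop
    simpa using this.tendsto x
  filter_upwards [hcont.eventually_lt_const (tsub_pos_of_lt (inv_lt_one_of_one_lt₀ hc))]
    with x' hx'
  set K : ℝ≥0 := ∑ i, ‖((x' i : ℝ) - x i) / w‖₊
  set φ : ℝ → ℝ := fun t => ∑ i, ((x' i : ℝ) - x i) / w * tent (x i) w t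
  have hφ : LipschitzWith K φ := by
    refine LipschitzWith.of_dist_le_mul fun s t => ?_
    rw [NNReal.coe_sum, Finset.sum_mul]
    refine dist_sum_sum_le_of_le _ fun i _ => ?_
    rw [Real.dist_eq, ← mul_sub, abs_mul, coe_nnnorm, Real.norm_eq_abs]
    gcongr
    simpa [Real.dist_eq] using (lipschitzWith_tent (x i) w).dist_le_mul s t
  have hφ_eq_zero {t : ℝ} (ht : ∀ i, w ≤ |t - x i|) : φ t = 0 :=
    Finset.sum_eq_zero fun i _ => by rw [tent_of_le_abs_sub (ht i), mul_zero]
  have hφ_node (i : Fin n) : φ (x i) = x' i - x i := by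
    simp only [φ]
    rw [Finset.sum_eq_single_of_mem i (Finset.mem_univ i) fun j _ hj => by
      rw [tent_of_le_abs_sub (hpairs j i hj), mul_zero]]
    rw [tent_self hw.le, div_mul_cancel₀ _ hw.ne']
  have hKc : (1 - K)⁻¹ ≤ c := by
    rw [lt_tsub_comm] at hx'
    exact inv_le_of_inv_le₀ (zero_lt_one.trans hc) hx'.le
  obtain ⟨T, hT, hlip, hlip_symm⟩ := exists_orderIso_add hφ (hx'.trans_le tsub_le_self)
  refine ⟨T, ⟨hlip.weaken hKc, hlip_symm.weaken hKc, ?_, ?_⟩, fun i => ?_⟩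
  · rw [hT, zero_add]
    exact hφ_eq_zero fun i => (hends i).1.trans (by rw [zero_sub, abs_neg]; exact le_abs_self _)
  · rw [hT, hφ_eq_zero fun i => ?_, add_zero]
    linarith [(hends i).2, le_abs_self (1 - (x i : ℝ))]
  · rw [hT, hφ_node, add_sub_cancel]

lemma ae_eval_ne_eval {ι α : Type*} [Fintype ι] [MeasurableSpace α] [MeasurableEq α]
    (μ : ι → Measure α) [∀ i, IsProbabilityMeasure (μ i)] {i j : ι} [NullSingletonClass (μ j)]
    (hij : i ≠ j) : ∀ᵐ x ∂Measure.pi μ, x i ≠ x j := by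
  have hindep : ProbabilityTheory.IndepFun (fun x : ι → α => x i) (fun x => x j)
      (Measure.pi μ) :=
    (ProbabilityTheory.iIndepFun_pi (X := fun _ => id) fun _ => aemeasurable_id).indepFun hij
  have hlaw : (Measure.pi μ).map (fun x => (x i, x j)) = (μ i).prod (μ j) := by
    rw [hindep.map_prod_eq_prod_map_map (measurable_pi_apply i).aemeasurable
      (measurable_pi_apply j).aemeasurable]
    congr 1
    · exact (measurePreserving_eval μ i).map_eq
    · exact (measurePreserving_eval μ j).map_eq
  have hdiag : ∀ᵐ z ∂(μ i).prod (μ j), z.1 ≠ z.2 := by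
    refine (Measure.ae_prod_iff_ae_ae measurableSet_diagonal.compl).2 (ae_of_all _ fun u => ?_)
    exact (measure_eq_zero_iff_ae_notMem.1 (measure_singleton u)).mono fun v hv => Ne.symm hv
  rw [← hlaw] at hdiag
  exact ae_of_ae_map (f := fun x : ι → α => (x i, x j)) (p := fun z => z.1 ≠ z.2)
    (by fun_prop) hdiag

lemma ae_mem_regularNodes (n : ℕ) : ∀ᵐ x : Fin n → unitInterval, x ∈ regularNodes n := by
  have hends (u : unitInterval) : ∀ᵐ x : Fin n → unitInterval, ∀ i, x i ≠ u :=
    ae_all_iff.2 fun i => Measure.ae_eval_ne (fun _ : Fin n => (volume : Measure unitInterval)) i u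
  have hpairs : ∀ᵐ x : Fin n → unitInterval, ∀ i j, i ≠ j → x i ≠ x j :=
    ae_all_iff.2 fun i => ae_all_iff.2 fun j => eventually_imp_distrib_left.2 fun hij =>
      ae_eval_ne_eval (fun _ => volume) hij
  filter_upwards [hends 0, hends 1, hpairs] with x h0 h1 hx
  exact ⟨fun i j => not_imp_not.1 (hx i j),
    fun i => ⟨unitInterval.pos_iff_ne_zero.2 (h0 i), unitInterval.lt_one_iff_ne_one.2 (h1 i)⟩⟩

-- On the full-measure set of regular nodes the radius is upper semicontinuous.
lemma aemeasurable_radius {p q : ℝ≥0∞} (hp : 1 ≤ p) (hq : 1 ≤ q) (n : ℕ) :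
    AEMeasurable fun x : Fin n → unitInterval => radius p q x := by
  classical
  refine ⟨fun x => if x ∈ regularNodes n then radius p q x else ⊤, ?_, ?_⟩
  · refine UpperSemicontinuous.measurable fun x ρ hρ => ?_
    have hx : x ∈ regularNodes n := by
      by_contra hx
      simp only [if_neg hx, not_top_lt] at hρ
    simp only [if_pos hx] at hρ
    have hlim : Tendsto (fun c : ℝ≥0 => (c : ℝ≥0∞) ^ 3 * radius p q x) (𝓝[>] 1)
        (𝓝 (radius p q x)) := by
      have hpow : Tendsto (fun c : ℝ≥0 => (c : ℝ≥0∞) ^ 3) (𝓝[>] 1) (𝓝 1) := by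
        have : Continuous fun c : ℝ≥0 => (c : ℝ≥0∞) ^ 3 :=
          (ENNReal.continuous_pow 3).comp ENNReal.continuous_coe
        simpa using (this.tendsto 1).mono_left nhdsWithin_le_nhds
      simpa using ENNReal.Tendsto.mul_const hpow (Or.inl one_ne_zero)
    obtain ⟨c, hcρ, hc⟩ := ((hlim.eventually_lt_const hρ).and self_mem_nhdsWithin).exists
    filter_upwards [eventually_exists_isReparam hx hc, (isOpen_regularNodes n).mem_nhds hx]
      with x' ⟨T, hT, hTx⟩ hx'
    rw [if_pos hx']
    exact (hT.radius_le hp hq hTx).trans_lt hcρ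
  · filter_upwards [ae_mem_regularNodes n] with x hx
    rw [if_pos hx]

end Measurability

section Partition

lemma one_sub_toReal_inv_nonneg {p : ℝ≥0∞} (hp : 1 ≤ p) : 0 ≤ 1 - p⁻¹.toReal := by
  rw [sub_nonneg, ← ENNReal.toReal_one]
  exact ENNReal.toReal_mono ENNReal.one_ne_top (ENNReal.inv_le_one.2 hp)

lemma lebesgue01_eq_restrict_Ico : lebesgue01 = volume.restrict (Ico 0 1) :=
  (Measure.restrict_congr_set Ico_ae_eq_Icc).symm

lemma eLpNorm_rpow_toReal {α : Type*} {_ : MeasurableSpace α} {μ : Measure α} {p : ℝ≥0∞}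
    (hp0 : p ≠ 0) (hp : p ≠ ⊤) (f : α → ℝ) :
    eLpNorm f p μ ^ p.toReal = ∫⁻ x, ‖f x‖ₑ ^ p.toReal ∂μ := by
  rw [eLpNorm_eq_lintegral_rpow_enorm_toReal hp0 hp, one_div,
    ENNReal.rpow_inv_rpow (ENNReal.toReal_pos hp0 hp).ne']

lemma eLpNorm_rpow_le_of_ae_enorm_le {α : Type*} {_ : MeasurableSpace α} {μ : Measure α}
    {p q : ℝ≥0∞} (hp : p ≠ 0) (hpq : p ≤ q) (hq : q ≠ ⊤) {f : α → ℝ}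
    (hf : AEStronglyMeasurable f μ) {B : ℝ≥0∞} (hB : ∀ᵐ x ∂μ, ‖f x‖ₑ ≤ B) :
    eLpNorm f q μ ^ q.toReal ≤ B ^ (q.toReal - p.toReal) * eLpNorm f p μ ^ p.toReal := by
  have hPQ : 0 ≤ q.toReal - p.toReal := sub_nonneg.2 (ENNReal.toReal_mono hq hpq)
  have hp' : p ≠ ⊤ := ne_top_of_le_ne_top hq hpq
  have hq0 : q ≠ 0 := (hp.bot_lt.trans_le hpq).ne'
  rw [eLpNorm_rpow_toReal hq0 hq, eLpNorm_rpow_toReal hp hp',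
    ← lintegral_const_mul'' _ (hf.enorm.pow_const _)]
  refine lintegral_mono_ae (hB.mono fun x hx => ?_)
  calc ‖f x‖ₑ ^ q.toReal = ‖f x‖ₑ ^ (q.toReal - p.toReal) * ‖f x‖ₑ ^ p.toReal := by
        rw [← ENNReal.rpow_add_of_nonneg _ _ hPQ ENNReal.toReal_nonneg, sub_add_cancel]
    _ ≤ B ^ (q.toReal - p.toReal) * ‖f x‖ₑ ^ p.toReal := by gcongr

lemma setLIntegral_enorm_le {α : Type*} {_ : MeasurableSpace α} {μ : Measure α} {p : ℝ≥0∞}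
    (hp : 1 ≤ p) {D : α → ℝ} (hD : Measurable D) (A : Set α) :
    ∫⁻ s in A, ‖D s‖ₑ ∂μ ≤ eLpNorm D p (μ.restrict A) * μ A ^ (1 - p⁻¹.toReal) := by
  simpa only [eLpNorm_one_eq_lintegral_enorm, Measure.restrict_apply_univ, ENNReal.toReal_one,
    div_one, one_div, ENNReal.toReal_inv]
    using eLpNorm_le_eLpNorm_mul_rpow_measure_univ hp
      (hD.aestronglyMeasurable (μ := μ.restrict A))

lemma setLIntegral_enorm_rpow_le {α : Type*} {_ : MeasurableSpace α} {μ : Measure α} {p : ℝ≥0∞}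
    (hp : 1 ≤ p) (hp' : p ≠ ⊤) {D : α → ℝ} (hD : Measurable D) {A : Set α} (hA0 : μ A ≠ 0)
    (hA : μ A ≠ ⊤) :
    (∫⁻ s in A, ‖D s‖ₑ ∂μ) ^ p.toReal
      ≤ μ A ^ p.toReal * ⨍⁻ s in A, ‖D s‖ₑ ^ p.toReal ∂μ := by
  have hP : 0 < p.toReal := ENNReal.toReal_pos (by positivity) hp'
  calc (∫⁻ s in A, ‖D s‖ₑ ∂μ) ^ p.toReal
      ≤ (eLpNorm D p (μ.restrict A) * μ A ^ (1 - p⁻¹.toReal)) ^ p.toReal := by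
        gcongr
        exact setLIntegral_enorm_le hp hD A
    _ = (∫⁻ s in A, ‖D s‖ₑ ^ p.toReal ∂μ) * μ A ^ (p.toReal - 1) := by
        rw [ENNReal.mul_rpow_of_nonneg _ _ hP.le, eLpNorm_rpow_toReal (by positivity) hp',
          ← ENNReal.rpow_mul, ENNReal.toReal_inv, sub_mul, one_mul, inv_mul_cancel₀ hP.ne']
    _ = μ A ^ p.toReal * ⨍⁻ s in A, ‖D s‖ₑ ^ p.toReal ∂μ := by
        rw [setLAverage_eq, ENNReal.rpow_sub _ _ hA0 hA, ENNReal.rpow_one, ENNReal.div_eq_inv_mul,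
          ENNReal.div_eq_inv_mul]
        ring

lemma setLIntegral_enorm_le_mul_rpow_setLAverage {α : Type*} {_ : MeasurableSpace α}
    {μ : Measure α} {p : ℝ≥0∞} (hp : 1 ≤ p) (hp' : p ≠ ⊤) {D : α → ℝ} (hD : Measurable D)
    {A : Set α} (hA0 : μ A ≠ 0) (hA : μ A ≠ ⊤) :
    ∫⁻ s in A, ‖D s‖ₑ ∂μ ≤ μ A * (⨍⁻ s in A, ‖D s‖ₑ ^ p.toReal ∂μ) ^ (1 / p.toReal) := by
  have hP : 0 < p.toReal := ENNReal.toReal_pos (by positivity) hp'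
  rw [← ENNReal.rpow_le_rpow_iff hP, ENNReal.mul_rpow_of_nonneg _ _ hP.le, ← ENNReal.rpow_mul,
    one_div_mul_cancel hP.ne', ENNReal.rpow_one]
  exact setLIntegral_enorm_rpow_le hp hp' hD hA0 hA

/-- The functions `L` and `R` encode a partition of `[0,1)` into half-open intervals: the interval
that contains `t ∈ [0,1)` is `[L t, R t)`. -/
structure IsPartition (L R : ℝ → ℝ) : Prop where
  measurable_left : Measurable L
  measurable_right : Measurable R
  nonneg : ∀ t, 0 ≤ L t
  le_one : ∀ t, R t ≤ 1
  mem : ∀ t ∈ Ico (0 : ℝ) 1, t ∈ Ico (L t) (R t)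
  const : ∀ t ∈ Ico (0 : ℝ) 1, ∀ s ∈ Ico (L t) (R t), L s = L t ∧ R s = R t

namespace IsPartition

variable {L R : ℝ → ℝ}

lemma subset (h : IsPartition L R) (t : ℝ) : Ico (L t) (R t) ⊆ Ico 0 1 :=
  Ico_subset_Ico (h.nonneg t) (h.le_one t)

lemma volume_ne_zero (h : IsPartition L R) {t : ℝ} (ht : t ∈ Ico (0 : ℝ) 1) :
    volume (Ico (L t) (R t)) ≠ 0 := by
  have hmem := h.mem t ht
  rw [Real.volume_Ico, ENNReal.ofReal_ne_zero_iff]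
  linarith [hmem.1, hmem.2]

lemma volume_ne_top (t : ℝ) : volume (Ico (L t) (R t)) ≠ ⊤ := measure_Ico_lt_top.ne

lemma measurable_volume (h : IsPartition L R) : Measurable fun t => volume (Ico (L t) (R t)) := by
  simp_rw [Real.volume_Ico]
  exact (h.measurable_right.sub h.measurable_left).ennreal_ofReal

lemma measurable_indicator (h : IsPartition L R) {u : ℝ → ℝ≥0∞} (hu : Measurable u) :
    Measurable fun z : ℝ × ℝ => (Ico (L z.1) (R z.1)).indicator u z.2 :=
  (hu.comp measurable_snd).indicator
    ((measurableSet_le (h.measurable_left.comp measurable_fst) measurable_snd).inter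
      (measurableSet_lt measurable_snd (h.measurable_right.comp measurable_fst)))

lemma measurable_setLAverage (h : IsPartition L R) {u : ℝ → ℝ≥0∞} (hu : Measurable u) :
    Measurable fun t => ⨍⁻ s in Ico (L t) (R t), u s ∂volume := by
  simp_rw [setLAverage_eq, ← lintegral_indicator measurableSet_Ico]
  exact (h.measurable_indicator hu).lintegral_prod_right'.div h.measurable_volume

lemma lintegral_indicator_div_volume_le (h : IsPartition L R) (u : ℝ → ℝ≥0∞) (s : ℝ) :
    ∫⁻ t in Ico (0 : ℝ) 1, (Ico (L t) (R t)).indicator u s / volume (Ico (L t) (R t))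
      ≤ (Ico (0 : ℝ) 1).indicator u s := by
  by_cases hs : s ∈ Ico (0 : ℝ) 1
  · have hcell (t) (ht : t ∈ Ico (0 : ℝ) 1) :
        (Ico (L t) (R t)).indicator u s / volume (Ico (L t) (R t))
          ≤ (Ico (L s) (R s)).indicator (fun _ => u s / volume (Ico (L s) (R s))) t := by
      by_cases hst : s ∈ Ico (L t) (R t)
      · obtain ⟨hL, hR⟩ := h.const t ht s hst
        rw [indicator_of_mem hst, hL, hR, indicator_of_mem (h.mem t ht)]
      · rw [indicator_of_notMem hst, ENNReal.zero_div]
        exact zero_le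
    calc ∫⁻ t in Ico (0 : ℝ) 1, (Ico (L t) (R t)).indicator u s / volume (Ico (L t) (R t))
        ≤ ∫⁻ t in Ico (0 : ℝ) 1,
            (Ico (L s) (R s)).indicator (fun _ => u s / volume (Ico (L s) (R s))) t :=
          setLIntegral_mono' measurableSet_Ico hcell
      _ ≤ ∫⁻ t, (Ico (L s) (R s)).indicator (fun _ => u s / volume (Ico (L s) (R s))) t :=
          setLIntegral_le_lintegral _ _
      _ = (Ico (0 : ℝ) 1).indicator u s := by
          rw [lintegral_indicator measurableSet_Ico, setLIntegral_const, indicator_of_mem hs,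
            ENNReal.div_mul_cancel (h.volume_ne_zero hs) (volume_ne_top s)]
  · have hnot_mem (t) : s ∉ Ico (L t) (R t) := fun hst => hs (h.subset t hst)
    simp only [indicator_of_notMem (hnot_mem _), ENNReal.zero_div, lintegral_zero, zero_le]

lemma lintegral_setLAverage_le (h : IsPartition L R) {u : ℝ → ℝ≥0∞} (hu : Measurable u) :
    ∫⁻ t in Ico (0 : ℝ) 1, ⨍⁻ s in Ico (L t) (R t), u s ∂volume ≤ ∫⁻ s in Ico (0 : ℝ) 1, u s := by
  have hmeas := (h.measurable_indicator hu).div (h.measurable_volume.comp measurable_fst)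
  calc ∫⁻ t in Ico (0 : ℝ) 1, ⨍⁻ s in Ico (L t) (R t), u s ∂volume
      = ∫⁻ t in Ico (0 : ℝ) 1, ∫⁻ s,
          (Ico (L t) (R t)).indicator u s / volume (Ico (L t) (R t)) := by
        refine lintegral_congr fun t => ?_
        simp only [setLAverage_eq, ENNReal.div_eq_inv_mul]
        rw [lintegral_const_mul _ (hu.indicator measurableSet_Ico),
          lintegral_indicator measurableSet_Ico]
    _ = ∫⁻ s, ∫⁻ t in Ico (0 : ℝ) 1,
          (Ico (L t) (R t)).indicator u s / volume (Ico (L t) (R t)) :=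
        lintegral_lintegral_swap hmeas.aemeasurable
    _ ≤ ∫⁻ s, (Ico (0 : ℝ) 1).indicator u s :=
        lintegral_mono (h.lintegral_indicator_div_volume_le u)
    _ = ∫⁻ s in Ico (0 : ℝ) 1, u s := lintegral_indicator measurableSet_Ico _

variable {p q : ℝ≥0∞} {D H : ℝ → ℝ} {δ : ℝ≥0∞}

lemma ae_enorm_le (h : IsPartition L R) (hp : 1 ≤ p) (hD : Measurable D)
    (hH : ∀ t ∈ Ico (0 : ℝ) 1, ‖H t‖ₑ ≤ ∫⁻ s in Ico (L t) (R t), ‖D s‖ₑ)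
    (hδ : ∀ t ∈ Ico (0 : ℝ) 1, volume (Ico (L t) (R t)) ≤ δ) :
    ∀ᵐ t ∂lebesgue01, ‖H t‖ₑ ≤ δ ^ (1 - p⁻¹.toReal) * eLpNorm D p lebesgue01 := by
  rw [lebesgue01_eq_restrict_Ico]
  filter_upwards [ae_restrict_mem measurableSet_Ico] with t ht
  calc ‖H t‖ₑ ≤ eLpNorm D p (volume.restrict (Ico (L t) (R t)))
        * volume (Ico (L t) (R t)) ^ (1 - p⁻¹.toReal) :=
        (hH t ht).trans (setLIntegral_enorm_le hp hD _)
    _ ≤ eLpNorm D p (volume.restrict (Ico 0 1)) * δ ^ (1 - p⁻¹.toReal) :=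
        mul_le_mul' (eLpNorm_mono_measure D (Measure.restrict_mono (h.subset t) le_rfl))
          (ENNReal.rpow_le_rpow (hδ t ht) (one_sub_toReal_inv_nonneg hp))
    _ = _ := mul_comm _ _

lemma eLpNorm_rpow_le_mul (h : IsPartition L R) (hp : 1 ≤ p) (hp' : p ≠ ⊤) (hD : Measurable D)
    (hH : ∀ t ∈ Ico (0 : ℝ) 1, ‖H t‖ₑ ≤ ∫⁻ s in Ico (L t) (R t), ‖D s‖ₑ)
    (hδ : ∀ t ∈ Ico (0 : ℝ) 1, volume (Ico (L t) (R t)) ≤ δ) :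
    eLpNorm H p lebesgue01 ^ p.toReal
      ≤ δ ^ p.toReal * eLpNorm D p lebesgue01 ^ p.toReal := by
  have hp0 : p ≠ 0 := by positivity
  rw [eLpNorm_rpow_toReal hp0 hp', eLpNorm_rpow_toReal hp0 hp', lebesgue01_eq_restrict_Ico]
  have hDm : Measurable fun s => ‖D s‖ₑ ^ p.toReal := hD.enorm.pow_const _
  calc ∫⁻ t in Ico (0 : ℝ) 1, ‖H t‖ₑ ^ p.toReal
      ≤ ∫⁻ t in Ico (0 : ℝ) 1,
          δ ^ p.toReal * ⨍⁻ s in Ico (L t) (R t), ‖D s‖ₑ ^ p.toReal ∂volume := by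
        refine setLIntegral_mono' measurableSet_Ico fun t ht => ?_
        calc ‖H t‖ₑ ^ p.toReal ≤ (∫⁻ s in Ico (L t) (R t), ‖D s‖ₑ) ^ p.toReal := by
              gcongr
              exact hH t ht
          _ ≤ volume (Ico (L t) (R t)) ^ p.toReal
                * ⨍⁻ s in Ico (L t) (R t), ‖D s‖ₑ ^ p.toReal ∂volume :=
              setLIntegral_enorm_rpow_le hp hp' hD (h.volume_ne_zero ht) (volume_ne_top t)
          _ ≤ _ := by
              gcongr
              exact hδ t ht
    _ = δ ^ p.toReal * ∫⁻ t in Ico (0 : ℝ) 1, ⨍⁻ s in Ico (L t) (R t), ‖D s‖ₑ ^ p.toReal ∂volume :=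
        lintegral_const_mul _ (h.measurable_setLAverage hDm)
    _ ≤ δ ^ p.toReal * ∫⁻ s in Ico (0 : ℝ) 1, ‖D s‖ₑ ^ p.toReal :=
        mul_le_mul_right (h.lintegral_setLAverage_le hDm) _

lemma eLpNorm_le_of_volume_le (h : IsPartition L R) (hp : 1 ≤ p) (hpq : p ≤ q)
    (hD : Measurable D) (hHm : AEStronglyMeasurable H lebesgue01)
    (hH : ∀ t ∈ Ico (0 : ℝ) 1, ‖H t‖ₑ ≤ ∫⁻ s in Ico (L t) (R t), ‖D s‖ₑ)
    (hδ : ∀ t ∈ Ico (0 : ℝ) 1, volume (Ico (L t) (R t)) ≤ δ) :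
    eLpNorm H q lebesgue01
      ≤ δ ^ (1 - p⁻¹.toReal + q⁻¹.toReal) * eLpNorm D p lebesgue01 := by
  rcases eq_or_ne q ⊤ with rfl | hq
  · rw [eLpNorm_exponent_top, ENNReal.inv_top, ENNReal.toReal_zero, add_zero]
    exact eLpNormEssSup_le_of_ae_enorm_bound (h.ae_enorm_le hp hD hH hδ)
  have hp' : p ≠ ⊤ := ne_top_of_le_ne_top hq hpq
  have hp0 : p ≠ 0 := by positivity
  have hP : 0 < p.toReal := ENNReal.toReal_pos hp0 hp'
  have hPQ : p.toReal ≤ q.toReal := ENNReal.toReal_mono hq hpq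
  have hQ : 0 < q.toReal := hP.trans_le hPQ
  have hexp := one_sub_toReal_inv_nonneg hp
  rw [← ENNReal.rpow_le_rpow_iff hQ]
  set M := eLpNorm D p lebesgue01
  calc eLpNorm H q lebesgue01 ^ q.toReal
      ≤ (δ ^ (1 - p⁻¹.toReal) * M) ^ (q.toReal - p.toReal)
          * (δ ^ p.toReal * M ^ p.toReal) :=
        (eLpNorm_rpow_le_of_ae_enorm_le hp0 hpq hq hHm (h.ae_enorm_le hp hD hH hδ)).trans
          (mul_le_mul_right (h.eLpNorm_rpow_le_mul hp hp' hD hH hδ) _)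
    _ = δ ^ ((1 - p⁻¹.toReal) * (q.toReal - p.toReal) + p.toReal)
          * M ^ (q.toReal - p.toReal + p.toReal) := by
        rw [ENNReal.mul_rpow_of_nonneg _ _ (sub_nonneg.2 hPQ), ← ENNReal.rpow_mul,
          ENNReal.rpow_add_of_nonneg _ _ (mul_nonneg hexp (sub_nonneg.2 hPQ)) hP.le,
          ENNReal.rpow_add_of_nonneg _ _ (sub_nonneg.2 hPQ) hP.le]
        ring
    _ = (δ ^ (1 - p⁻¹.toReal + q⁻¹.toReal) * M) ^ q.toReal := by
        rw [ENNReal.mul_rpow_of_nonneg _ _ hQ.le, ← ENNReal.rpow_mul, sub_add_cancel,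
          ENNReal.toReal_inv, ENNReal.toReal_inv]
        congr 2
        field_simp
        ring

lemma eLpNorm_le_lintegral_volume_rpow (h : IsPartition L R) (hq : 1 ≤ q) (hqp : q < p)
    (hp' : p ≠ ⊤) (hD : Measurable D)
    (hH : ∀ t ∈ Ico (0 : ℝ) 1, ‖H t‖ₑ ≤ ∫⁻ s in Ico (L t) (R t), ‖D s‖ₑ) {α : ℝ}
    (hα : 1 / q.toReal = 1 / α + 1 / p.toReal) :
    eLpNorm H q lebesgue01
      ≤ (∫⁻ t in Ico (0 : ℝ) 1, volume (Ico (L t) (R t)) ^ α) ^ (1 / α)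
        * eLpNorm D p lebesgue01 := by
  have hp : 1 ≤ p := hq.trans hqp.le
  have hQ : 0 < q.toReal := ENNReal.toReal_pos (by positivity) hqp.ne_top
  have hQP : q.toReal < p.toReal := (ENNReal.toReal_lt_toReal hqp.ne_top hp').2 hqp
  have hP : 0 < p.toReal := hQ.trans hQP
  have hα_pos : 0 < 1 / α := by linarith [one_div_lt_one_div_of_lt hQ hQP]
  have hQα : q.toReal < α :=
    lt_of_one_div_lt_one_div (one_div_pos.1 hα_pos) (by linarith [one_div_pos.2 hP])
  have hDm : Measurable fun s => ‖D s‖ₑ ^ p.toReal := hD.enorm.pow_const _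
  set v : ℝ → ℝ≥0∞ := fun t => (⨍⁻ s in Ico (L t) (R t), ‖D s‖ₑ ^ p.toReal ∂volume) ^ (1 / p.toReal)
  have hHv (t) (ht : t ∈ Ico (0 : ℝ) 1) : ‖H t‖ₑ ≤ volume (Ico (L t) (R t)) * v t :=
    (hH t ht).trans <| setLIntegral_enorm_le_mul_rpow_setLAverage hp hp' hD
      (h.volume_ne_zero ht) (volume_ne_top t)
  rw [lebesgue01_eq_restrict_Ico, eLpNorm_eq_lintegral_rpow_enorm_toReal (by positivity) hqp.ne_top,
    eLpNorm_eq_lintegral_rpow_enorm_toReal (by positivity) hp']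
  calc (∫⁻ t in Ico (0 : ℝ) 1, ‖H t‖ₑ ^ q.toReal) ^ (1 / q.toReal)
      ≤ (∫⁻ t in Ico (0 : ℝ) 1, (volume (Ico (L t) (R t)) * v t) ^ q.toReal)
          ^ (1 / q.toReal) := by
        gcongr ?_ ^ _
        exact setLIntegral_mono' measurableSet_Ico fun t ht =>
          ENNReal.rpow_le_rpow (hHv t ht) hQ.le
    _ ≤ (∫⁻ t in Ico (0 : ℝ) 1, volume (Ico (L t) (R t)) ^ α) ^ (1 / α)
          * (∫⁻ t in Ico (0 : ℝ) 1, v t ^ p.toReal) ^ (1 / p.toReal) :=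
        ENNReal.lintegral_Lp_mul_le_Lq_mul_Lr hQ hQα hα _ h.measurable_volume.aemeasurable
          ((h.measurable_setLAverage hDm).pow_const _).aemeasurable
    _ ≤ _ := by
        simp only [v, ← ENNReal.rpow_mul, one_div_mul_cancel hP.ne', ENNReal.rpow_one]
        exact mul_le_mul_right
          (ENNReal.rpow_le_rpow (h.lintegral_setLAverage_le hDm) (one_div_pos.2 hP).le) _

end IsPartition

end Partition

section Gaps

variable {n : ℕ}

/-- The largest node that is at most `t`, or `0` if there is none: the left endpoint of the gap
between nodes that contains `t`. -/
noncomputable def leftNode (x : Fin n → unitInterval) (t : ℝ) : unitInterval :=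
  Finset.univ.sup fun i => if (x i : ℝ) ≤ t then x i else ⊥

/-- The smallest node that is larger than `t`, or `1` if there is none: the right endpoint of the
gap between nodes that contains `t`. -/
noncomputable def rightNode (x : Fin n → unitInterval) (t : ℝ) : unitInterval :=
  Finset.univ.inf fun i => if t < x i then x i else ⊤

variable {x : Fin n → unitInterval} {t : ℝ} {i : Fin n}

lemma le_leftNode (h : (x i : ℝ) ≤ t) : x i ≤ leftNode x t :=
  (if_pos h).ge.trans (Finset.le_sup (f := fun i => if (x i : ℝ) ≤ t then x i else ⊥)
    (Finset.mem_univ i))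

lemma rightNode_le (h : t < x i) : rightNode x t ≤ x i :=
  (Finset.inf_le (f := fun i => if t < x i then x i else ⊤) (Finset.mem_univ i)).trans
    (if_pos h).le

lemma leftNode_le (x : Fin n → unitInterval) (ht : t ∈ Ico (0 : ℝ) 1) :
    (leftNode x t : ℝ) ≤ t := by
  suffices leftNode x t ≤ ⟨t, ht.1, ht.2.le⟩ from this
  refine Finset.sup_le fun i _ => ?_
  split_ifs with h
  · exact h
  · exact bot_le

lemma lt_rightNode (x : Fin n → unitInterval) (ht : t ∈ Ico (0 : ℝ) 1) :
    t < rightNode x t := by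
  have htop : (⟨t, ht.1, ht.2.le⟩ : unitInterval) < ⊤ := ht.2
  suffices ⟨t, ht.1, ht.2.le⟩ < rightNode x t from this
  refine (Finset.lt_inf_iff htop).2 fun i _ => ?_
  split_ifs with h
  · exact h
  · exact htop

lemma measurable_leftNode :
    Measurable fun z : (Fin n → unitInterval) × ℝ => (leftNode z.1 z.2 : ℝ) := by
  refine measurable_subtype_coe.comp ?_
  have hsup : (fun z : (Fin n → unitInterval) × ℝ => leftNode z.1 z.2) =
      Finset.univ.sup fun (i : Fin n) z => if (z.1 i : ℝ) ≤ z.2 then z.1 i else ⊥ := by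
    ext z
    simp [leftNode, Finset.sup_apply]
  rw [hsup]
  refine Finset.sup_induction (p := Measurable) measurable_const (fun _ h _ h' => h.sup h')
    fun i _ => ?_
  exact Measurable.ite (measurableSet_le (by fun_prop) (by fun_prop)) (by fun_prop) (by fun_prop)

lemma measurable_rightNode :
    Measurable fun z : (Fin n → unitInterval) × ℝ => (rightNode z.1 z.2 : ℝ) := by
  refine measurable_subtype_coe.comp ?_
  have hinf : (fun z : (Fin n → unitInterval) × ℝ => rightNode z.1 z.2) =
      Finset.univ.inf fun (i : Fin n) z => if z.2 < z.1 i then z.1 i else ⊤ := by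
    ext z
    simp [rightNode, Finset.inf_apply]
  rw [hinf]
  refine Finset.inf_induction (p := Measurable) measurable_const (fun _ h _ h' => h.inf h')
    fun i _ => ?_
  exact Measurable.ite (measurableSet_lt (by fun_prop) (by fun_prop)) (by fun_prop) (by fun_prop)

lemma isPartition_nodes (x : Fin n → unitInterval) :
    IsPartition (fun t => leftNode x t) (fun t => rightNode x t) where
  measurable_left := measurable_leftNode.comp measurable_prodMk_left
  measurable_right := measurable_rightNode.comp measurable_prodMk_left
  nonneg t := (leftNode x t).2.1
  le_one t := (rightNode x t).2.2
  mem t ht := ⟨leftNode_le x ht, lt_rightNode x ht⟩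
  const t _ s hs := by
    have hle (i) : (x i : ℝ) ≤ s ↔ (x i : ℝ) ≤ t := by
      refine ⟨fun his => ?_, fun hit => (Subtype.coe_le_coe.2 (le_leftNode hit)).trans hs.1⟩
      by_contra! hti
      exact (hs.2.trans_le (rightNode_le hti)).not_ge his
    have hlt (i) : s < x i ↔ t < x i := by rw [← not_le, ← not_le, hle i]
    simp only [leftNode, rightNode, hle, hlt, and_self]

lemma exists_eq_leftNode_or_eq_rightNode (hn : n ≠ 0) (x : Fin n → unitInterval) (t : ℝ) :
    ∃ i, x i = leftNode x t ∨ x i = rightNode x t := by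
  have : NeZero n := ⟨hn⟩
  obtain ⟨i, -, hi⟩ := Finset.exists_mem_eq_sup Finset.univ Finset.univ_nonempty
    fun i => if (x i : ℝ) ≤ t then x i else ⊥
  obtain ⟨j, -, hj⟩ := Finset.exists_mem_eq_inf Finset.univ Finset.univ_nonempty
    fun i => if t < x i then x i else ⊤
  rw [← leftNode] at hi
  rw [← rightNode] at hj
  by_cases hit : (x i : ℝ) ≤ t
  · exact ⟨i, Or.inl (by rw [hi, if_pos hit])⟩
  by_cases htj : t < x j
  · exact ⟨j, Or.inr (by rw [hj, if_pos htj])⟩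
  · have htop : rightNode x t = ⊤ := by rw [hj, if_neg htj]
    exact ⟨i, Or.inr ((htop ▸ le_top).antisymm (rightNode_le (not_le.1 hit)))⟩

lemma enorm_sub_le_setLIntegral_deriv {f g : ℝ → ℝ} (hf : AbsolutelyContinuousOnInterval f 0 1)
    (hg : AbsolutelyContinuousOnInterval g 0 1) {a b s : ℝ} (ha : 0 ≤ a) (hb : b ≤ 1)
    (hs : s ∈ Icc a b) (hfg : f s = g s) (ht : t ∈ Icc a b) :
    ‖(f - g) t‖ₑ ≤ ∫⁻ u in Ico a b, ‖(deriv f - deriv g) u‖ₑ := by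
  have hst : uIcc s t ⊆ Icc a b := ordConnected_Icc.uIcc_subset hs ht
  have hst01 : uIcc s t ⊆ uIcc 0 1 := by
    rw [uIcc_of_le (zero_le_one' ℝ)]
    exact hst.trans (Icc_subset_Icc ha hb)
  have hf' := hf.mono hst01
  have hg' := hg.mono hst01
  have hftc : (f - g) t = ∫ u in s..t, (deriv f - deriv g) u := by
    simp only [Pi.sub_apply]
    rw [intervalIntegral.integral_sub hf'.intervalIntegrable_deriv hg'.intervalIntegrable_deriv,
      hf'.integral_deriv_eq_sub, hg'.integral_deriv_eq_sub, hfg]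
    ring
  calc ‖(f - g) t‖ₑ = ‖∫ u in uIoc s t, (deriv f - deriv g) u‖ₑ := by
        rw [hftc, ← ofReal_norm, ← ofReal_norm, intervalIntegral.norm_intervalIntegral_eq]
    _ ≤ ∫⁻ u in uIoc s t, ‖(deriv f - deriv g) u‖ₑ := enorm_integral_le_lintegral_enorm _
    _ ≤ ∫⁻ u in Icc a b, ‖(deriv f - deriv g) u‖ₑ :=
        lintegral_mono_set (uIoc_subset_uIcc.trans hst)
    _ = ∫⁻ u in Ico a b, ‖(deriv f - deriv g) u‖ₑ := by
        rw [Measure.restrict_congr_set Ico_ae_eq_Icc]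

variable {p q : ℝ≥0∞}

lemma enorm_sub_le_setLIntegral_gap (hn : n ≠ 0) {f g : ℝ → ℝ} (hf : f ∈ unitBall p)
    (hg : g ∈ unitBall p) (hfg : info x f = info x g) (ht : t ∈ Ico (0 : ℝ) 1) :
    ‖(f - g) t‖ₑ
      ≤ ∫⁻ s in Ico (leftNode x t : ℝ) (rightNode x t), ‖(deriv f - deriv g) s‖ₑ := by
  obtain ⟨i, hi⟩ := exists_eq_leftNode_or_eq_rightNode hn x t
  have htgap := Ico_subset_Icc_self ((isPartition_nodes x).mem t ht)
  have hxi : (x i : ℝ) ∈ Icc (leftNode x t : ℝ) (rightNode x t) := by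
    rcases hi with hi | hi <;> rw [hi]
    · exact left_mem_Icc.2 (htgap.1.trans htgap.2)
    · exact right_mem_Icc.2 (htgap.1.trans htgap.2)
  exact enorm_sub_le_setLIntegral_deriv hf.1.1 hg.1.1 (leftNode x t).2.1 (rightNode x t).2.2 hxi
    (congrFun hfg i) htgap

lemma radius_le_of_gap_le (hp : 1 ≤ p) (hpq : p ≤ q) (hn : n ≠ 0) {δ : ℝ}
    (hδ : ∀ t ∈ Ico (0 : ℝ) 1, (rightNode x t : ℝ) - leftNode x t ≤ δ) :
    radius p q x ≤ ENNReal.ofReal δ ^ (1 - p⁻¹.toReal + q⁻¹.toReal) * 2 := by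
  refine radius_le_of_forall fun f hf g hg hfg => ?_
  refine ((isPartition_nodes x).eLpNorm_le_of_volume_le hp hpq
    ((measurable_deriv f).sub (measurable_deriv g))
    (hf.1.aestronglyMeasurable.sub hg.1.aestronglyMeasurable)
    (fun t ht => enorm_sub_le_setLIntegral_gap hn hf hg hfg ht) fun t ht => ?_).trans
    (mul_le_mul_right (eLpNorm_deriv_sub_le_two hp hf hg) _)
  rw [Real.volume_Ico]
  exact ENNReal.ofReal_le_ofReal (hδ t ht)

lemma radius_le_lintegral_gap_rpow {r : ℝ≥0∞} (hq : 1 ≤ q) (hqr : q < r) (hr : r ≠ ⊤)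
    (hrp : r ≤ p) (hn : n ≠ 0) {α : ℝ} (hα : 1 / q.toReal = 1 / α + 1 / r.toReal) :
    radius p q x
      ≤ (∫⁻ t in Ico (0 : ℝ) 1, ENNReal.ofReal (rightNode x t - leftNode x t) ^ α) ^ (1 / α)
        * 2 := by
  refine radius_le_of_forall fun f hf g hg hfg => ?_
  have hm : Measurable (deriv f - deriv g) := (measurable_deriv f).sub (measurable_deriv g)
  have hle_two : eLpNorm (deriv f - deriv g) r lebesgue01 ≤ 2 :=
    (eLpNorm_le_eLpNorm_of_exponent_le hrp hm.aestronglyMeasurable).trans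
      (eLpNorm_deriv_sub_le_two (hq.trans (hqr.le.trans hrp)) hf hg)
  have hgap := (isPartition_nodes x).eLpNorm_le_lintegral_volume_rpow hq hqr hr hm
    (fun t ht => enorm_sub_le_setLIntegral_gap hn hf hg hfg ht) hα
  simp_rw [Real.volume_Ico] at hgap
  exact hgap.trans (mul_le_mul_right hle_two _)

lemma gap_le_of_forall_exists_abs_sub_le {δ : ℝ}
    (hδ : ∀ t ∈ Icc (0 : ℝ) 1, ∃ i, |(x i : ℝ) - t| ≤ δ) (t : ℝ) :
    (rightNode x t : ℝ) - leftNode x t ≤ 2 * δ := by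
  by_contra! hlt
  obtain ⟨hL0, hL1⟩ := (leftNode x t).2
  obtain ⟨hR0, hR1⟩ := (rightNode x t).2
  obtain ⟨i, hi⟩ := hδ (((leftNode x t : ℝ) + rightNode x t) / 2)
    ⟨by linarith, by linarith⟩
  rw [abs_le] at hi
  rcases le_or_gt (x i : ℝ) t with hit | hti
  · have hle : (x i : ℝ) ≤ leftNode x t := le_leftNode hit
    linarith
  · have hle : (rightNode x t : ℝ) ≤ x i := rightNode_le hti
    linarith

lemma radius_le_of_forall_exists_abs_sub_le (hp : 1 ≤ p) (hpq : p ≤ q) (hn : n ≠ 0) {δ : ℝ}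
    (hδ : ∀ t ∈ Icc (0 : ℝ) 1, ∃ i, |(x i : ℝ) - t| ≤ δ) :
    radius p q x ≤ ENNReal.ofReal (2 * δ) ^ (1 - p⁻¹.toReal + q⁻¹.toReal) * 2 :=
  radius_le_of_gap_le hp hpq hn fun t _ => gap_le_of_forall_exists_abs_sub_le hδ t

lemma radius_le_two (hp : 1 ≤ p) (hpq : p ≤ q) (hn : n ≠ 0) : radius p q x ≤ 2 := by
  have hgap : ∀ t ∈ Ico (0 : ℝ) 1, (rightNode x t : ℝ) - leftNode x t ≤ 1 := fun t _ => by
    linarith [(leftNode x t).2.1, (rightNode x t).2.2]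
  simpa only [ENNReal.ofReal_one, ENNReal.one_rpow, one_mul]
    using radius_le_of_gap_le hp hpq hn hgap

end Gaps

section Avoid

variable {n : ℕ} {A : Set ℝ} {a b : ℝ}

/-- The event that none of the `n` nodes lies in `A`. -/
def avoid (n : ℕ) (A : Set ℝ) : Set (Fin n → unitInterval) := {x | ∀ i, (x i : ℝ) ∉ A}

lemma avoid_eq_pi (n : ℕ) (A : Set ℝ) :
    avoid n A = univ.pi fun _ => ((↑) : unitInterval → ℝ) ⁻¹' Aᶜ := by
  ext x
  simp [avoid]

lemma avoid_inter (n : ℕ) (A B : Set ℝ) : avoid n A ∩ avoid n B = avoid n (A ∪ B) := by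
  ext x
  simp [avoid, forall_and]

lemma measurableSet_avoid (hA : MeasurableSet A) : MeasurableSet (avoid n A) := by
  rw [avoid_eq_pi]
  exact MeasurableSet.univ_pi fun _ => measurable_subtype_coe hA.compl

lemma volume_avoid (hA : MeasurableSet A) : volume (avoid n A) = (1 - lebesgue01 A) ^ n := by
  rw [avoid_eq_pi, volume_pi_pi, Finset.prod_const, Finset.card_univ, Fintype.card_fin,
    unitInterval.measurePreserving_coe.measure_preimage hA.compl.nullMeasurableSet,
    prob_compl_eq_one_sub hA]

lemma lebesgue01_Ioo (ha : 0 ≤ a) (hb : b ≤ 1) :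
    lebesgue01 (Ioo a b) = ENNReal.ofReal (b - a) := by
  rw [Measure.restrict_apply measurableSet_Ioo,
    inter_eq_left.2 (Ioo_subset_Icc_self.trans (Icc_subset_Icc ha hb)), Real.volume_Ioo]

lemma volume_avoid_Ioo_le (ha : 0 ≤ a) (hab : a ≤ b) (hb : b ≤ 1) :
    volume (avoid n (Ioo a b)) ≤ ENNReal.ofReal (Real.exp (-(n * (b - a)))) := by
  have hab' := sub_nonneg.2 hab
  calc volume (avoid n (Ioo a b)) = ENNReal.ofReal (1 - (b - a)) ^ n := by
        rw [volume_avoid measurableSet_Ioo, lebesgue01_Ioo ha hb, ENNReal.ofReal_sub 1 hab',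
          ENNReal.ofReal_one]
    _ ≤ ENNReal.ofReal (Real.exp (-(b - a))) ^ n := by
        gcongr
        exact Real.one_sub_le_exp_neg _
    _ = ENNReal.ofReal (Real.exp (-(n * (b - a)))) := by
        rw [← ENNReal.ofReal_pow (Real.exp_nonneg _), ← Real.exp_nat_mul, mul_neg]

end Avoid

section ExpectedGap

variable {n : ℕ} {t δ : ℝ}

lemma volume_add_le_rightNode_le (ht : t ∈ Ico (0 : ℝ) 1) (hδ : 0 ≤ δ) :
    volume {x : Fin n → unitInterval | t + δ ≤ rightNode x t}
      ≤ ENNReal.ofReal (Real.exp (-(n * δ))) := by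
  rcases le_or_gt (t + δ) 1 with h | h
  · have hsub : {x : Fin n → unitInterval | t + δ ≤ rightNode x t}
        ⊆ avoid n (Ioo t (t + δ)) := fun x hx i hi =>
      (hi.2.trans_le hx).not_ge (Subtype.coe_le_coe.2 (rightNode_le hi.1))
    simpa only [add_sub_cancel_left] using
      (measure_mono hsub).trans (volume_avoid_Ioo_le ht.1 (by linarith) h)
  · have hempty : {x : Fin n → unitInterval | t + δ ≤ rightNode x t} = ∅ :=
      eq_empty_of_forall_notMem fun x hx => (h.trans_le hx).not_ge (rightNode x t).2.2
    rw [hempty, measure_empty]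
    exact zero_le

lemma volume_leftNode_le_sub_le (ht : t ∈ Ico (0 : ℝ) 1) (hδ : 0 ≤ δ) :
    volume {x : Fin n → unitInterval | (leftNode x t : ℝ) ≤ t - δ}
      ≤ ENNReal.ofReal (Real.exp (-(n * δ))) := by
  rcases le_or_gt 0 (t - δ) with h | h
  · have hsub : {x : Fin n → unitInterval | (leftNode x t : ℝ) ≤ t - δ}
        ⊆ avoid n (Ioo (t - δ) t) := fun x hx i hi =>
      (hx.trans_lt hi.1).not_ge (Subtype.coe_le_coe.2 (le_leftNode hi.2.le))
    simpa only [sub_sub_cancel] using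
      (measure_mono hsub).trans (volume_avoid_Ioo_le h (by linarith) ht.2.le)
  · have hempty : {x : Fin n → unitInterval | (leftNode x t : ℝ) ≤ t - δ} = ∅ :=
      eq_empty_of_forall_notMem fun x hx => (hx.trans_lt h).not_ge (leftNode x t).2.1
    rw [hempty, measure_empty]
    exact zero_le

lemma volume_le_gap_le (ht : t ∈ Ico (0 : ℝ) 1) (hδ : 0 ≤ δ) :
    volume {x : Fin n → unitInterval | δ ≤ (rightNode x t : ℝ) - leftNode x t}
      ≤ 2 * ENNReal.ofReal (Real.exp (-(n / 2 * δ))) := by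
  have hsub : {x : Fin n → unitInterval | δ ≤ (rightNode x t : ℝ) - leftNode x t}
      ⊆ {x | t + δ / 2 ≤ rightNode x t} ∪ {x | (leftNode x t : ℝ) ≤ t - δ / 2} := by
    intro x hx
    rw [mem_ofPred_eq] at hx
    by_contra! h
    simp only [mem_union, mem_ofPred_eq, not_or, not_le] at h
    linarith
  have hexp : (n : ℝ) / 2 * δ = n * (δ / 2) := by ring
  rw [hexp, two_mul]
  exact (measure_mono hsub).trans ((measure_union_le _ _).trans
    (add_le_add (volume_add_le_rightNode_le ht (by linarith))
      (volume_leftNode_le_sub_le ht (by linarith))))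

lemma lintegral_rpow_le_of_exp_tail {Ω : Type*} [MeasurableSpace Ω] {μ : Measure Ω} {Y : Ω → ℝ}
    (hY : AEMeasurable Y μ) (hY0 : 0 ≤ᵐ[μ] Y) {α c : ℝ} (hα : 0 < α) (hc : 0 < c) {C : ℝ≥0∞}
    (htail : ∀ s > 0, μ {ω | s ≤ Y ω} ≤ C * ENNReal.ofReal (Real.exp (-(c * s)))) :
    ∫⁻ ω, ENNReal.ofReal (Y ω ^ α) ∂μ
      ≤ C * ENNReal.ofReal ((1 / c) ^ α * Real.Gamma (α + 1)) := by
  have hint : IntegrableOn (fun s : ℝ => s ^ (α - 1) * Real.exp (-(c * s))) (Ioi 0) := by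
    simpa only [Real.rpow_one, neg_mul] using
      integrableOn_rpow_mul_exp_neg_mul_rpow (by linarith : -1 < α - 1) one_pos hc
  calc ∫⁻ ω, ENNReal.ofReal (Y ω ^ α) ∂μ
      = ENNReal.ofReal α * ∫⁻ s in Ioi 0, μ {ω | s ≤ Y ω} * ENNReal.ofReal (s ^ (α - 1)) :=
        lintegral_rpow_eq_lintegral_meas_le_mul μ hY0 hY hα
    _ ≤ ENNReal.ofReal α * ∫⁻ s in Ioi 0,
          C * ENNReal.ofReal (s ^ (α - 1) * Real.exp (-(c * s))) := by
        refine mul_le_mul_right (setLIntegral_mono' measurableSet_Ioi fun s hs => ?_) _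
        rw [ENNReal.ofReal_mul (Real.rpow_nonneg (le_of_lt hs) _), mul_comm (ENNReal.ofReal _),
          ← mul_assoc]
        gcongr
        exact htail s hs
    _ = ENNReal.ofReal α * (C * ENNReal.ofReal ((1 / c) ^ α * Real.Gamma α)) := by
        rw [lintegral_const_mul _ (by fun_prop), ← ofReal_integral_eq_lintegral_ofReal hint,
          Real.integral_rpow_mul_exp_neg_mul_Ioi hα hc]
        filter_upwards [ae_restrict_mem measurableSet_Ioi] with s hs
        exact mul_nonneg (Real.rpow_nonneg (le_of_lt hs) _) (Real.exp_nonneg _)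
    _ = C * ENNReal.ofReal ((1 / c) ^ α * Real.Gamma (α + 1)) := by
        rw [mul_left_comm, ← ENNReal.ofReal_mul hα.le, Real.Gamma_add_one hα.ne',
          mul_left_comm α]

lemma lintegral_gap_rpow_le (hn : n ≠ 0) (ht : t ∈ Ico (0 : ℝ) 1) {α : ℝ} (hα : 0 < α) :
    ∫⁻ x : Fin n → unitInterval, ENNReal.ofReal (rightNode x t - leftNode x t) ^ α
      ≤ 2 * ENNReal.ofReal ((2 / n) ^ α * Real.Gamma (α + 1)) := by
  have hgap0 (x : Fin n → unitInterval) : 0 ≤ (rightNode x t : ℝ) - leftNode x t :=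
    sub_nonneg.2 ((leftNode_le x ht).trans (lt_rightNode x ht).le)
  have hn0 : 0 < (n : ℝ) / 2 := by positivity
  simp_rw [ENNReal.ofReal_rpow_of_nonneg (hgap0 _) hα.le, ← one_div_div (n : ℝ) 2]
  exact lintegral_rpow_le_of_exp_tail
    ((measurable_rightNode.sub measurable_leftNode).comp measurable_prodMk_right).aemeasurable
    (ae_of_all _ hgap0) hα hn0 fun s hs => volume_le_gap_le ht (le_of_lt hs)

lemma lintegral_rpow_one_div_le {Ω : Type*} [MeasurableSpace Ω] {μ : Measure Ω}
    [IsProbabilityMeasure μ] {f : Ω → ℝ≥0∞} (hf : AEMeasurable f μ) {α : ℝ} (hα : 1 ≤ α) :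
    ∫⁻ ω, f ω ^ (1 / α) ∂μ ≤ (∫⁻ ω, f ω ∂μ) ^ (1 / α) := by
  have hα0 : α ≠ 0 := by positivity
  have h := eLpNorm'_le_eLpNorm'_of_exponent_le one_pos hα μ
    (hf.pow_const (1 / α)).aestronglyMeasurable
  simpa only [eLpNorm', enorm_eq_self, ENNReal.rpow_one, div_one, ← ENNReal.rpow_mul,
    one_div_mul_cancel hα0] using h

lemma lintegral_lintegral_gap_rpow_le (hn : n ≠ 0) {α : ℝ} (hα : 1 ≤ α) :
    ∫⁻ x : Fin n → unitInterval,
        (∫⁻ t in Ico (0 : ℝ) 1, ENNReal.ofReal (rightNode x t - leftNode x t) ^ α) ^ (1 / α)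
      ≤ ENNReal.ofReal (2 * Real.Gamma (α + 1)) ^ (1 / α) * ENNReal.ofReal (2 / n) := by
  have hα0 : 0 < α := one_pos.trans_le hα
  have hn0 : 0 ≤ 2 / (n : ℝ) := by positivity
  have hmeas : Measurable fun z : (Fin n → unitInterval) × ℝ =>
      ENNReal.ofReal ((rightNode z.1 z.2 : ℝ) - leftNode z.1 z.2) ^ α :=
    (measurable_rightNode.sub measurable_leftNode).ennreal_ofReal.pow_const α
  refine (lintegral_rpow_one_div_le hmeas.lintegral_prod_right'.aemeasurable hα).trans ?_
  calc (∫⁻ x : Fin n → unitInterval, ∫⁻ t in Ico (0 : ℝ) 1,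
          ENNReal.ofReal (rightNode x t - leftNode x t) ^ α) ^ (1 / α)
      = (∫⁻ t in Ico (0 : ℝ) 1, ∫⁻ x : Fin n → unitInterval,
          ENNReal.ofReal (rightNode x t - leftNode x t) ^ α) ^ (1 / α) := by
        rw [lintegral_lintegral_swap hmeas.aemeasurable]
    _ ≤ (∫⁻ _ in Ico (0 : ℝ) 1,
          2 * ENNReal.ofReal ((2 / n) ^ α * Real.Gamma (α + 1))) ^ (1 / α) :=
        ENNReal.rpow_le_rpow (setLIntegral_mono' measurableSet_Ico fun t ht =>
          lintegral_gap_rpow_le hn ht hα0) (by positivity)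
    _ = (ENNReal.ofReal (2 * Real.Gamma (α + 1)) * ENNReal.ofReal (2 / n) ^ α) ^ (1 / α) := by
        rw [setLIntegral_const, Real.volume_Ico, sub_zero, ENNReal.ofReal_one, mul_one,
          ENNReal.ofReal_rpow_of_nonneg hn0 hα0.le, ENNReal.ofReal_mul (by positivity),
          ENNReal.ofReal_mul zero_le_two, ENNReal.ofReal_ofNat, mul_left_comm, mul_comm]
    _ = _ := by
        rw [ENNReal.mul_rpow_of_nonneg _ _ (by positivity), ← ENNReal.rpow_mul,
          mul_one_div_cancel hα0.ne', ENNReal.rpow_one]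

lemma exists_expectedRadius_le_mul_inv {p q : ℝ≥0∞} (hq : 1 ≤ q) (hqp : q < p) :
    ∃ C : ℝ≥0∞, C ≠ ⊤ ∧ ∀ n : ℕ, n ≠ 0 → expectedRadius p q n ≤ C * (n : ℝ≥0∞)⁻¹ := by
  obtain ⟨r, hqr, hrp⟩ := exists_between hqp
  have hr : r ≠ ⊤ := hrp.ne_top
  have hQ : 1 ≤ q.toReal := by simpa using ENNReal.toReal_mono hqr.ne_top hq
  have hQR : q.toReal < r.toReal := (ENNReal.toReal_lt_toReal hqr.ne_top hr).2 hqr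
  obtain ⟨α, hα1, hα⟩ : ∃ α : ℝ, 1 ≤ α ∧ 1 / q.toReal = 1 / α + 1 / r.toReal := by
    have hpos : 0 < 1 / q.toReal - 1 / r.toReal :=
      sub_pos.2 (one_div_lt_one_div_of_lt (one_pos.trans_le hQ) hQR)
    have hle : 1 / q.toReal - 1 / r.toReal ≤ 1 := by
      have : 0 ≤ 1 / r.toReal := by positivity
      linarith [div_le_one_of_le₀ hQ (zero_le_one.trans hQ)]
    exact ⟨(1 / q.toReal - 1 / r.toReal)⁻¹, one_le_inv₀ hpos |>.2 hle, by
      rw [one_div (_⁻¹), inv_inv, sub_add_cancel]⟩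
  refine ⟨ENNReal.ofReal (2 * Real.Gamma (α + 1)) ^ (1 / α) * 2 * 2, ?_, fun n hn => ?_⟩
  · have : 0 ≤ 1 / α := by positivity
    finiteness
  calc expectedRadius p q n
      ≤ ∫⁻ x : Fin n → unitInterval, (∫⁻ t in Ico (0 : ℝ) 1,
          ENNReal.ofReal (rightNode x t - leftNode x t) ^ α) ^ (1 / α) * 2 :=
        lintegral_mono fun x => radius_le_lintegral_gap_rpow hq hqr hr hrp.le hn hα
    _ ≤ ENNReal.ofReal (2 * Real.Gamma (α + 1)) ^ (1 / α) * ENNReal.ofReal (2 / n) * 2 := by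
        rw [lintegral_mul_const' _ _ ENNReal.ofNat_ne_top]
        exact mul_le_mul_left (lintegral_lintegral_gap_rpow_le hn hα1) 2
    _ = _ := by
        rw [ENNReal.ofReal_div_of_pos (by positivity), ENNReal.ofReal_ofNat,
          ENNReal.ofReal_natCast, div_eq_mul_inv (2 : ℝ≥0∞)]
        ring

end ExpectedGap

section Cell

variable {m j : ℕ}

/-- The `j`-th of the `m` open intervals of equal length into which `[0,1]` is divided, for
`j < m`. -/
def cell (m j : ℕ) : Set ℝ := Ioo ((j : ℝ) / m) (((j : ℝ) + 1) / m)

lemma measurableSet_cell (m j : ℕ) : MeasurableSet (cell m j) := measurableSet_Ioo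

lemma add_one_div_le_one (hj : j < m) : ((j : ℝ) + 1) / m ≤ 1 :=
  div_le_one_of_le₀ (by exact_mod_cast hj) (Nat.cast_nonneg m)

lemma lebesgue01_cell (hj : j < m) : lebesgue01 (cell m j) = ENNReal.ofReal (1 / m) := by
  rw [cell, lebesgue01_Ioo (by positivity) (add_one_div_le_one hj), add_div, add_sub_cancel_left]

lemma pairwise_disjoint_cell (m : ℕ) : Pairwise (Function.onFun Disjoint (cell m)) := by
  refine (pairwise_disjoint_on _).2 fun i j hij => Set.disjoint_left.2 fun u hu hv => ?_
  have hle : ((i : ℝ) + 1) / m ≤ j / m := by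
    gcongr
    exact_mod_cast hij
  exact (hu.2.trans_le hle).not_gt hv.1

lemma exists_mem_Icc_div (hm : m ≠ 0) {t : ℝ} (ht : t ∈ Icc (0 : ℝ) 1) :
    ∃ j < m, t ∈ Icc ((j : ℝ) / m) (((j : ℝ) + 1) / m) := by
  have hm0 : (0 : ℝ) < m := by positivity
  have htm : 0 ≤ t * m := mul_nonneg ht.1 hm0.le
  simp_rw [mem_Icc, div_le_iff₀ hm0, le_div_iff₀ hm0]
  rcases ht.2.lt_or_eq with h1 | rfl
  · exact ⟨⌊t * m⌋₊, (Nat.floor_lt htm).2 (mul_lt_of_lt_one_left hm0 h1), Nat.floor_le htm,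
      (Nat.lt_floor_add_one _).le⟩
  · exact ⟨m - 1, by lia, by simp [Nat.cast_pred (Nat.pos_of_ne_zero hm)]⟩

variable {n : ℕ} {p q : ℝ≥0∞}

lemma radius_le_of_forall_notMem_avoid (hp : 1 ≤ p) (hpq : p ≤ q) (hn : n ≠ 0) (hm : m ≠ 0)
    {x : Fin n → unitInterval} (hx : ∀ j < m, x ∉ avoid n (cell m j)) :
    radius p q x ≤ ENNReal.ofReal (2 * (1 / m)) ^ (1 - p⁻¹.toReal + q⁻¹.toReal) * 2 := by
  refine radius_le_of_forall_exists_abs_sub_le hp hpq hn fun t ht => ?_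
  obtain ⟨j, hj, htj⟩ := exists_mem_Icc_div hm ht
  obtain ⟨i, hi⟩ : ∃ i, (x i : ℝ) ∈ cell m j := by simpa [avoid] using hx j hj
  rw [cell, add_div] at hi
  rw [add_div] at htj
  exact ⟨i, abs_le.2 ⟨by linarith [hi.1, htj.2], by linarith [hi.2, htj.1]⟩⟩

lemma optimalRadius_le (hp : 1 ≤ p) (hpq : p ≤ q) (hm : m ≠ 0) :
    optimalRadius p q m
      ≤ ENNReal.ofReal (2 * (1 / m)) ^ (1 - p⁻¹.toReal + q⁻¹.toReal) * 2 := by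
  have hmem (j : Fin m) : (j : ℝ) / m ∈ Icc (0 : ℝ) 1 :=
    ⟨by positivity, div_le_one_of_le₀ (by exact_mod_cast j.2.le) (by positivity)⟩
  refine iInf_le_of_le (fun j : Fin m => ⟨(j : ℝ) / m, hmem j⟩)
    (radius_le_of_forall_exists_abs_sub_le hp hpq hm fun t ht => ?_)
  obtain ⟨j, hj, htj⟩ := exists_mem_Icc_div hm ht
  rw [add_div] at htj
  exact ⟨⟨j, hj⟩, abs_le.2 ⟨by linarith [htj.2], by linarith [htj.1, htj.2]⟩⟩

lemma volume_biUnion_avoid_cell_le (n m : ℕ) :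
    volume (⋃ j ∈ Finset.range m, avoid n (cell m j))
      ≤ ENNReal.ofReal (m * Real.exp (-(n / m))) := by
  calc volume (⋃ j ∈ Finset.range m, avoid n (cell m j))
      ≤ ∑ j ∈ Finset.range m, volume (avoid n (cell m j)) := measure_biUnion_finset_le _ _
    _ ≤ ∑ _j ∈ Finset.range m, ENNReal.ofReal (Real.exp (-(n / m))) := by
        refine Finset.sum_le_sum fun j hj => ?_
        refine (volume_avoid_Ioo_le (by positivity) (by gcongr; linarith)
          (add_one_div_le_one (Finset.mem_range.1 hj))).trans_eq ?_
        rw [add_div, add_sub_cancel_left, mul_one_div]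
    _ = ENNReal.ofReal (m * Real.exp (-(n / m))) := by
        rw [Finset.sum_const, Finset.card_range, nsmul_eq_mul, ENNReal.ofReal_mul (by positivity),
          ENNReal.ofReal_natCast]

lemma expectedRadius_le (hp : 1 ≤ p) (hpq : p ≤ q) (hn : n ≠ 0) (hm : m ≠ 0) :
    expectedRadius p q n ≤ ENNReal.ofReal (2 * (1 / m)) ^ (1 - p⁻¹.toReal + q⁻¹.toReal) * 2
      + 2 * ENNReal.ofReal (m * Real.exp (-(n / m))) := by
  set bad : Set (Fin n → unitInterval) := ⋃ j ∈ Finset.range m, avoid n (cell m j)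
  set B := ENNReal.ofReal (2 * (1 / m)) ^ (1 - p⁻¹.toReal + q⁻¹.toReal) * 2
  have hbad : MeasurableSet bad :=
    Finset.measurableSet_biUnion _ fun j _ => measurableSet_avoid (measurableSet_cell m j)
  have hradius (x : Fin n → unitInterval) : radius p q x ≤ B + bad.indicator (fun _ => 2) x := by
    by_cases hx : x ∈ bad
    · rw [indicator_of_mem hx]
      exact le_add_left (radius_le_two hp hpq hn)
    · refine le_add_right (radius_le_of_forall_notMem_avoid hp hpq hn hm fun j hj hxj => hx ?_)
      exact mem_biUnion (Finset.mem_coe.2 (Finset.mem_range.2 hj)) hxj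
  calc expectedRadius p q n
      ≤ ∫⁻ x : Fin n → unitInterval, (B + bad.indicator (fun _ => 2) x) := lintegral_mono hradius
    _ = B + 2 * volume bad := by
        rw [lintegral_add_left measurable_const, lintegral_indicator hbad, setLIntegral_const,
          lintegral_const, measure_univ, mul_one]
    _ ≤ _ := by
        gcongr
        exact volume_biUnion_avoid_cell_le n m

end Cell

section SecondMoment

variable {Ω : Type*} [MeasurableSpace Ω] {μ : Measure Ω}

lemma sq_lintegral_mul_le {f g : Ω → ℝ≥0∞} (hf : AEMeasurable f μ) (hg : AEMeasurable g μ) :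
    (∫⁻ ω, f ω * g ω ∂μ) ^ 2 ≤ (∫⁻ ω, f ω ^ 2 ∂μ) * ∫⁻ ω, g ω ^ 2 ∂μ := by
  have h := ENNReal.lintegral_mul_le_Lp_mul_Lq μ .two_two hf hg
  simp only [Pi.mul_apply, ENNReal.rpow_two] at h
  have hsq (y : ℝ≥0∞) : (y ^ (1 / 2 : ℝ)) ^ 2 = y := by
    rw [← ENNReal.rpow_two, ← ENNReal.rpow_mul, one_div_mul_cancel two_ne_zero, ENNReal.rpow_one]
  calc (∫⁻ ω, f ω * g ω ∂μ) ^ 2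
      ≤ ((∫⁻ ω, f ω ^ 2 ∂μ) ^ (1 / 2 : ℝ) * (∫⁻ ω, g ω ^ 2 ∂μ) ^ (1 / 2 : ℝ)) ^ 2 := by gcongr
    _ = (∫⁻ ω, f ω ^ 2 ∂μ) * ∫⁻ ω, g ω ^ 2 ∂μ := by rw [mul_pow, hsq, hsq]

variable {ι : Type*} [Fintype ι] {A : ι → Set Ω}

-- The Chung–Erdős inequality: Cauchy–Schwarz for the number of events that occur and the indicator
-- function of the union.
lemma sq_sum_measure_le_measure_iUnion_mul (hA : ∀ i, MeasurableSet (A i)) :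
    (∑ i, μ (A i)) ^ 2 ≤ μ (⋃ i, A i) * ∑ i, ∑ j, μ (A i ∩ A j) := by
  set Z : Ω → ℝ≥0∞ := fun ω => ∑ i, (A i).indicator 1 ω
  have hU : MeasurableSet (⋃ i, A i) := MeasurableSet.iUnion hA
  have hind {s : Set Ω} (hs : MeasurableSet s) : Measurable (s.indicator (1 : Ω → ℝ≥0∞)) :=
    measurable_one.indicator hs
  have hZ : Measurable Z := Finset.measurable_sum _ fun i _ => hind (hA i)
  have hUZ (ω : Ω) : (⋃ i, A i).indicator 1 ω * Z ω = Z ω := by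
    by_cases hω : ω ∈ ⋃ i, A i
    · rw [indicator_of_mem hω, Pi.one_apply, one_mul]
    · have hZ0 : Z ω = 0 := Finset.sum_eq_zero fun i _ =>
        indicator_of_notMem (fun hi => hω (mem_iUnion_of_mem i hi)) _
      rw [hZ0, mul_zero]
  have hUU (ω : Ω) : (⋃ i, A i).indicator (1 : Ω → ℝ≥0∞) ω ^ 2 = (⋃ i, A i).indicator 1 ω := by
    rw [sq, ← Pi.mul_apply, ← inter_indicator_one, inter_self]
  have hZZ (ω : Ω) : Z ω ^ 2 = ∑ i, ∑ j, (A i ∩ A j).indicator 1 ω := by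
    simp only [Z, sq, Finset.sum_mul_sum, inter_indicator_one, Pi.mul_apply]
  have h := sq_lintegral_mul_le (hind hU).aemeasurable hZ.aemeasurable (μ := μ)
  simp_rw [hUZ, hUU, hZZ] at h
  rw [lintegral_indicator_one hU, lintegral_finsetSum _ fun i _ => hind (hA i),
    lintegral_finsetSum _ fun i _ =>
      Finset.measurable_sum _ fun j _ => hind ((hA i).inter (hA j))] at h
  simp_rw [lintegral_finsetSum Finset.univ fun j _ => hind ((hA _).inter (hA j)),
    lintegral_indicator_one (hA _), lintegral_indicator_one ((hA _).inter (hA _))] at h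
  exact h

lemma half_le_measure_iUnion [IsFiniteMeasure μ] (hA : ∀ i, MeasurableSet (A i))
    (hinter : ∀ i j, i ≠ j → μ (A i ∩ A j) ≤ μ (A i) * μ (A j)) (hsum : 1 ≤ ∑ i, μ (A i)) :
    1 / 2 ≤ μ (⋃ i, A i) := by
  classical
  set S := ∑ i, μ (A i) with hS
  have hS0 : S ^ 2 ≠ 0 := pow_ne_zero 2 (one_pos.trans_le hsum).ne'
  have hS1 : S ^ 2 ≠ ⊤ := ENNReal.pow_ne_top (ENNReal.sum_ne_top.2 fun i _ => measure_ne_top μ _)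
  have hpairs : ∑ i, ∑ j, μ (A i ∩ A j) ≤ 2 * S ^ 2 := by
    calc ∑ i, ∑ j, μ (A i ∩ A j)
        ≤ ∑ i, ∑ j, ((if i = j then μ (A i) else 0) + μ (A i) * μ (A j)) := by
          refine Finset.sum_le_sum fun i _ => Finset.sum_le_sum fun j _ => ?_
          split_ifs with hij
          · rw [hij, inter_self]
            exact le_self_add
          · rw [zero_add]
            exact hinter i j hij
      _ = S + S ^ 2 := by
          simp only [Finset.sum_add_distrib, Finset.sum_ite_eq, Finset.mem_univ, if_true,
            ← Finset.sum_mul_sum, hS, sq]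
      _ ≤ 2 * S ^ 2 := by
          rw [two_mul]
          gcongr
          rw [sq]
          exact le_mul_of_one_le_left' hsum
  rw [ENNReal.div_le_iff two_ne_zero ENNReal.ofNat_ne_top]
  refine (ENNReal.mul_le_mul_iff_left hS0 hS1).1 ?_
  calc 1 * S ^ 2 ≤ μ (⋃ i, A i) * (2 * S ^ 2) :=
        (one_mul _).trans_le ((sq_sum_measure_le_measure_iUnion_mul hA).trans (by gcongr))
    _ = μ (⋃ i, A i) * 2 * S ^ 2 := (mul_assoc _ _ _).symm

lemma volume_avoid_inter_le {n : ℕ} {A B : Set ℝ} (hA : MeasurableSet A) (hB : MeasurableSet B)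
    (hAB : Disjoint A B) :
    volume (avoid n A ∩ avoid n B) ≤ volume (avoid n A) * volume (avoid n B) := by
  rw [avoid_inter, volume_avoid (hA.union hB), volume_avoid hA, volume_avoid hB, ← mul_pow,
    measure_union hAB hB]
  gcongr
  rw [tsub_add_eq_tsub_tsub, ENNReal.mul_sub fun _ _ => by finiteness, mul_one]
  exact tsub_le_tsub_left (mul_le_of_le_one_left' tsub_le_self) _

lemma half_le_volume_iUnion_avoid_cell {n m : ℕ} (hm : 1 ≤ (m : ℝ) * (1 - 1 / m) ^ n) :
    1 / 2 ≤ volume (⋃ j : Fin m, avoid n (cell m j)) := by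
  have hinv : 0 ≤ 1 - 1 / (m : ℝ) := sub_nonneg.2 ((one_div _).trans_le (Nat.cast_inv_le_one m))
  have hvol (j : Fin m) : volume (avoid n (cell m j)) = ENNReal.ofReal ((1 - 1 / m) ^ n) := by
    rw [volume_avoid (measurableSet_cell m j), lebesgue01_cell j.2, ENNReal.ofReal_pow hinv,
      ENNReal.ofReal_sub 1 (by positivity), ENNReal.ofReal_one]
  refine half_le_measure_iUnion (fun j => measurableSet_avoid (measurableSet_cell m j))
    (fun i j hij => volume_avoid_inter_le (measurableSet_cell m i) (measurableSet_cell m j)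
      (pairwise_disjoint_cell m (Fin.val_ne_of_ne hij))) ?_
  simp_rw [hvol]
  rw [Finset.sum_const, Finset.card_univ, Fintype.card_fin, nsmul_eq_mul,
    ← ENNReal.ofReal_natCast, ← ENNReal.ofReal_mul (Nat.cast_nonneg m)]
  exact ENNReal.one_le_ofReal.2 hm

end SecondMoment

section LowerBounds

variable {p q : ℝ≥0∞} {n : ℕ} {x : Fin n → unitInterval} {f : ℝ → ℝ} {c w : ℝ}

lemma enorm_mul_eLpNorm_le_radius (hp : 1 ≤ p) (hq : 1 ≤ q) {K : ℝ≥0} (hf : LipschitzWith K f)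
    (hfx : ∀ i, f (x i) = 0) {a : ℝ} (hval : ‖a‖ₑ * eLpNorm f p lebesgue01 ≤ 2⁻¹)
    (hderiv : ‖a‖ₑ * eLpNorm (deriv f) p lebesgue01 ≤ 2⁻¹) :
    ‖a‖ₑ * eLpNorm f q lebesgue01 ≤ radius p q x := by
  have hderiv_smul : deriv (a • f) = a • deriv f := by
    ext t
    rw [deriv_const_smul_field, Pi.smul_apply]
  rw [← eLpNorm_const_smul] at hval hderiv ⊢
  refine eLpNorm_le_radius hq (mem_unitBall_of_lipschitzWith hp
    ((lipschitzWith_smul a).comp hf) hval (hderiv_smul ▸ hderiv)) fun i => ?_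
  rw [Pi.smul_apply, hfx, smul_zero]

lemma eLpNorm_le_of_norm_le_indicator (hf : ∀ t, ‖f t‖ ≤ (Icc (c - w) (c + w)).indicator 1 t) :
    eLpNorm f p lebesgue01 ≤ ENNReal.ofReal (2 * w) ^ p⁻¹.toReal := by
  calc eLpNorm f p lebesgue01
      ≤ eLpNorm ((Icc (c - w) (c + w)).indicator fun _ => (1 : ℝ)) p lebesgue01 :=
        eLpNorm_mono_real hf
    _ ≤ ‖(1 : ℝ)‖ₑ * lebesgue01 (Icc (c - w) (c + w)) ^ (1 / p.toReal) :=
        eLpNorm_indicator_const_le 1 p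
    _ ≤ ENNReal.ofReal (2 * w) ^ p⁻¹.toReal := by
      rw [enorm_one, one_mul, ENNReal.toReal_inv, one_div]
      gcongr
      refine (Measure.restrict_apply_le _ _).trans_eq ?_
      rw [Real.volume_Icc, add_sub_sub_cancel, two_mul]

lemma tent_of_notMem {t : ℝ} (ht : t ∉ Ioo (c - w) (c + w)) : tent c w t = 0 := by
  refine tent_of_le_abs_sub (not_lt.1 fun h => ht ?_)
  rwa [← Real.ball_eq_Ioo, Metric.mem_ball, Real.dist_eq]

lemma eLpNorm_tent_le (hw0 : 0 ≤ w) (hw1 : w ≤ 1) :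
    eLpNorm (tent c w) p lebesgue01 ≤ ENNReal.ofReal (2 * w) ^ p⁻¹.toReal := by
  refine eLpNorm_le_of_norm_le_indicator (c := c) fun t => ?_
  by_cases ht : t ∈ Icc (c - w) (c + w)
  · rw [indicator_of_mem ht, Real.norm_of_nonneg tent_nonneg]
    exact (tent_le hw0).trans hw1
  · rw [indicator_of_notMem ht, tent_of_notMem fun h => ht (Ioo_subset_Icc_self h), norm_zero]

lemma eLpNorm_deriv_tent_le :
    eLpNorm (deriv (tent c w)) p lebesgue01 ≤ ENNReal.ofReal (2 * w) ^ p⁻¹.toReal := by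
  refine eLpNorm_le_of_norm_le_indicator (c := c) fun t => ?_
  by_cases ht : t ∈ Icc (c - w) (c + w)
  · rw [indicator_of_mem ht]
    exact norm_deriv_le_of_lipschitz (lipschitzWith_tent c w)
  · have hzero : tent c w =ᶠ[𝓝 t] fun _ => 0 := by
      filter_upwards [isClosed_Icc.isOpen_compl.mem_nhds ht] with s hs
      exact tent_of_notMem fun h => hs (Ioo_subset_Icc_self h)
    rw [indicator_of_notMem ht, hzero.deriv_eq, deriv_const, norm_zero]

lemma le_eLpNorm_tent (hq : q ≠ 0) (hw : 0 < w) (h0 : 0 ≤ c - w) (h1 : c + w ≤ 1) :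
    ENNReal.ofReal (w / 2) * ENNReal.ofReal w ^ q⁻¹.toReal ≤ eLpNorm (tent c w) q lebesgue01 := by
  set J := Icc (c - w / 2) (c + w / 2)
  have hJ : lebesgue01 J = ENNReal.ofReal w := by
    rw [Measure.restrict_apply measurableSet_Icc,
      inter_eq_left.2 (Icc_subset_Icc (by linarith) (by linarith)), Real.volume_Icc,
      add_sub_sub_cancel, add_halves]
  have hJ0 : lebesgue01 J ≠ 0 := hJ ▸ (ENNReal.ofReal_pos.2 hw).ne'
  calc ENNReal.ofReal (w / 2) * ENNReal.ofReal w ^ q⁻¹.toReal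
      = eLpNorm (J.indicator fun _ => w / 2) q lebesgue01 := by
        rw [eLpNorm_indicator_const' measurableSet_Icc hJ0 hq, hJ,
          Real.enorm_of_nonneg (by positivity), one_div, ← ENNReal.toReal_inv]
    _ ≤ eLpNorm (tent c w) q lebesgue01 := by
        refine eLpNorm_mono fun t => ?_
        by_cases ht : t ∈ J
        · have habs : |t - c| ≤ w / 2 := abs_le.2 ⟨by linarith [ht.1], by linarith [ht.2]⟩
          rw [indicator_of_mem ht, Real.norm_of_nonneg (by positivity),
            Real.norm_of_nonneg tent_nonneg]
          exact le_max_of_le_right (by linarith)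
        · rw [indicator_of_notMem ht, norm_zero]
          exact norm_nonneg _

lemma rpow_div_eight_le {a b : ℝ} (hw : 0 < w) (ha : a ≤ 1) :
    w ^ (1 - a + b) / 8 ≤ (2 * w) ^ (-a) / 2 * (w / 2 * w ^ b) := by
  have htwo : (1 : ℝ) / 2 ≤ 2 ^ (-a) := by
    rw [one_div, ← Real.rpow_neg_one]
    exact Real.rpow_le_rpow_of_exponent_le one_le_two (neg_le_neg ha)
  calc w ^ (1 - a + b) / 8 = 1 / 2 * (w * w ^ (-a) * w ^ b / 4) := by
        rw [sub_eq_add_neg, Real.rpow_add hw, Real.rpow_add hw, Real.rpow_one]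
        ring
    _ ≤ 2 ^ (-a) * (w * w ^ (-a) * w ^ b / 4) := by gcongr
    _ = (2 * w) ^ (-a) / 2 * (w / 2 * w ^ b) := by
        rw [Real.mul_rpow zero_le_two hw.le]
        ring

lemma rpow_le_radius (hp : 1 ≤ p) (hq : 1 ≤ q) (hw : 0 < w) (h0 : 0 ≤ c - w) (h1 : c + w ≤ 1)
    (hx : x ∈ avoid n (Ioo (c - w) (c + w))) :
    ENNReal.ofReal (w ^ (1 - p⁻¹.toReal + q⁻¹.toReal) / 8) ≤ radius p q x := by
  set a := p⁻¹.toReal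
  set b := q⁻¹.toReal
  set A : ℝ := (2 * w) ^ (-a) / 2 with hA
  have hA0 : 0 ≤ A := by positivity
  have hscale {y : ℝ≥0∞} (hy : y ≤ ENNReal.ofReal (2 * w) ^ a) : ‖A‖ₑ * y ≤ 2⁻¹ := by
    refine (mul_le_mul_right hy _).trans_eq ?_
    rw [Real.enorm_of_nonneg hA0, ENNReal.ofReal_rpow_of_pos (by positivity),
      ← ENNReal.ofReal_mul hA0, hA, div_mul_eq_mul_div, ← Real.rpow_add (by positivity),
      neg_add_cancel, Real.rpow_zero, one_div, ENNReal.ofReal_inv_of_pos two_pos,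
      ENNReal.ofReal_ofNat]
  calc ENNReal.ofReal (w ^ (1 - a + b) / 8)
      ≤ ‖A‖ₑ * (ENNReal.ofReal (w / 2) * ENNReal.ofReal w ^ b) := by
        rw [Real.enorm_of_nonneg hA0, ENNReal.ofReal_rpow_of_pos hw,
          ← ENNReal.ofReal_mul (by positivity), ← ENNReal.ofReal_mul hA0]
        exact ENNReal.ofReal_le_ofReal
          (rpow_div_eight_le hw (sub_nonneg.1 (one_sub_toReal_inv_nonneg hp)))
    _ ≤ ‖A‖ₑ * eLpNorm (tent c w) q lebesgue01 :=
        mul_le_mul_right (le_eLpNorm_tent (one_pos.trans_le hq).ne' hw h0 h1) _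
    _ ≤ radius p q x :=
        enorm_mul_eLpNorm_le_radius hp hq (lipschitzWith_tent c w)
          (fun i => tent_of_notMem (hx i)) (hscale (eLpNorm_tent_le hw.le (by linarith)))
          (hscale eLpNorm_deriv_tent_le)

lemma rpow_le_radius_of_mem_avoid_cell (hp : 1 ≤ p) (hq : 1 ≤ q) {m j : ℕ} (hj : j < m)
    (hx : x ∈ avoid n (cell m j)) :
    ENNReal.ofReal ((1 / (2 * m)) ^ (1 - p⁻¹.toReal + q⁻¹.toReal) / 8) ≤ radius p q x := by
  have hm : (0 : ℝ) < m := by exact_mod_cast j.zero_le.trans_lt hj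
  have hleft : (j : ℝ) / m = (2 * j + 1) / (2 * m) - 1 / (2 * m) := by
    field_simp
    ring
  have hright : ((j : ℝ) + 1) / m = (2 * j + 1) / (2 * m) + 1 / (2 * m) := by
    field_simp
    ring
  rw [cell, hleft, hright] at hx
  exact rpow_le_radius hp hq (by positivity) (by rw [← hleft]; positivity)
    (by rw [← hright]; exact add_one_div_le_one hj) hx

lemma exists_mem_avoid_cell {m : ℕ} (hnm : n < m) (x : Fin n → unitInterval) :
    ∃ j < m, x ∈ avoid n (cell m j) := by
  by_contra! hall
  have hhit (j : Fin m) : ∃ i, (x i : ℝ) ∈ cell m j := by simpa [avoid] using hall j j.2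
  choose i hi using hhit
  have hinj : Function.Injective i := by
    intro j k hjk
    by_contra hne
    exact Set.disjoint_left.1 (pairwise_disjoint_cell m (Fin.val_ne_of_ne hne)) (hi j)
      (hjk ▸ hi k)
  simpa [hnm.not_ge] using Fintype.card_le_of_injective i hinj

lemma le_optimalRadius (hp : 1 ≤ p) (hq : 1 ≤ q) {m : ℕ} (hnm : n < m) :
    ENNReal.ofReal ((1 / (2 * m)) ^ (1 - p⁻¹.toReal + q⁻¹.toReal) / 8) ≤ optimalRadius p q n := by
  refine le_iInf fun x => ?_
  obtain ⟨j, hj, hx⟩ := exists_mem_avoid_cell hnm x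
  exact rpow_le_radius_of_mem_avoid_cell hp hq hj hx

lemma le_expectedRadius (hp : 1 ≤ p) (hq : 1 ≤ q) {m : ℕ}
    (hm : 1 ≤ (m : ℝ) * (1 - 1 / m) ^ n) :
    ENNReal.ofReal ((1 / (2 * m)) ^ (1 - p⁻¹.toReal + q⁻¹.toReal) / 8) * (1 / 2)
      ≤ expectedRadius p q n := by
  set B := ENNReal.ofReal ((1 / (2 * m)) ^ (1 - p⁻¹.toReal + q⁻¹.toReal) / 8)
  set G : Set (Fin n → unitInterval) := ⋃ j : Fin m, avoid n (cell m j)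
  have hG : MeasurableSet G :=
    MeasurableSet.iUnion fun j => measurableSet_avoid (measurableSet_cell m j)
  calc B * (1 / 2) ≤ B * volume G := by
        gcongr
        exact half_le_volume_iUnion_avoid_cell hm
    _ = ∫⁻ _ in G, B := (setLIntegral_const G B).symm
    _ ≤ ∫⁻ x in G, radius p q x := by
        refine setLIntegral_mono' hG fun x hx => ?_
        obtain ⟨j, hj⟩ := mem_iUnion.1 hx
        exact rpow_le_radius_of_mem_avoid_cell hp hq j.2 hj
    _ ≤ expectedRadius p q n := setLIntegral_le_lintegral _ _

lemma lebesgue01_iUnion_ball_le (x : Fin n → unitInterval) (δ : ℝ) :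
    lebesgue01 (⋃ i, Metric.ball (x i : ℝ) δ) ≤ ENNReal.ofReal (n * (2 * δ)) := by
  calc lebesgue01 (⋃ i, Metric.ball (x i : ℝ) δ)
      ≤ ∑ i : Fin n, lebesgue01 (Metric.ball (x i : ℝ) δ) := measure_iUnion_fintype_le _ _
    _ ≤ ∑ _i : Fin n, ENNReal.ofReal (2 * δ) := Finset.sum_le_sum fun i _ =>
        (Measure.restrict_apply_le _ _).trans_eq (Real.volume_ball _ _)
    _ = ENNReal.ofReal (n * (2 * δ)) := by
        rw [Finset.sum_const, Finset.card_univ, Fintype.card_fin, nsmul_eq_mul,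
          ← ENNReal.ofReal_natCast, ← ENNReal.ofReal_mul n.cast_nonneg]

lemma inv_le_lintegral_infDist (hn : n ≠ 0) (x : Fin n → unitInterval) :
    ENNReal.ofReal (1 / (8 * n))
      ≤ ∫⁻ t, ENNReal.ofReal (Metric.infDist t (range fun i => (x i : ℝ))) ∂lebesgue01 := by
  have : NeZero n := ⟨hn⟩
  set δ : ℝ := 1 / (4 * n) with hδ
  set N : Set ℝ := ⋃ i, Metric.ball (x i : ℝ) δ
  have hN : MeasurableSet N := MeasurableSet.iUnion fun i => Metric.isOpen_ball.measurableSet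
  have hcompl : ENNReal.ofReal (1 / 2) ≤ lebesgue01 Nᶜ := by
    have hhalf : (1 : ℝ) / 2 = 1 - n * (2 * δ) := by
      rw [hδ]
      field_simp
      norm_num
    rw [hhalf, prob_compl_eq_one_sub hN, ENNReal.ofReal_sub 1 (by positivity), ENNReal.ofReal_one]
    exact tsub_le_tsub_left (lebesgue01_iUnion_ball_le x δ) 1
  have hfar {t : ℝ} (ht : t ∈ Nᶜ) : δ ≤ Metric.infDist t (range fun i => (x i : ℝ)) := by
    rw [Metric.le_infDist (range_nonempty _), forall_mem_range]
    exact fun i => not_lt.1 fun hlt => ht (mem_iUnion.2 ⟨i, hlt⟩)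
  calc ENNReal.ofReal (1 / (8 * n)) = ENNReal.ofReal δ * ENNReal.ofReal (1 / 2) := by
        rw [← ENNReal.ofReal_mul (by positivity), hδ]
        congr 1
        field_simp
        norm_num
    _ ≤ ENNReal.ofReal δ * lebesgue01 Nᶜ := by gcongr
    _ = ∫⁻ _ in Nᶜ, ENNReal.ofReal δ ∂lebesgue01 := (setLIntegral_const _ _).symm
    _ ≤ ∫⁻ t in Nᶜ, ENNReal.ofReal (Metric.infDist t (range fun i => (x i : ℝ))) ∂lebesgue01 :=
        setLIntegral_mono' hN.compl fun t ht => ENNReal.ofReal_le_ofReal (hfar ht)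
    _ ≤ _ := setLIntegral_le_lintegral _ _

lemma inv_le_optimalRadius (hp : 1 ≤ p) (hq : 1 ≤ q) (hn : n ≠ 0) :
    ENNReal.ofReal (1 / (16 * n)) ≤ optimalRadius p q n := by
  refine le_iInf fun x => ?_
  set d : ℝ → ℝ := fun t => Metric.infDist t (range fun i => (x i : ℝ))
  have hlip : LipschitzWith 1 d := Metric.lipschitz_infDist_pt _
  have hscale {g : ℝ → ℝ} (hg : ∀ t ∈ Icc (0 : ℝ) 1, ‖g t‖ ≤ 1) :
      ‖(2⁻¹ : ℝ)‖ₑ * eLpNorm g p lebesgue01 ≤ 2⁻¹ := by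
    have hg' := eLpNorm_le_of_ae_bound (p := p)
      ((ae_restrict_mem measurableSet_Icc).mono hg : ∀ᵐ t ∂lebesgue01, ‖g t‖ ≤ 1)
    rw [measure_univ, ENNReal.one_rpow, one_mul, ENNReal.ofReal_one] at hg'
    rw [enorm_inv two_ne_zero, Real.enorm_of_nonneg zero_le_two, ENNReal.ofReal_ofNat]
    exact mul_le_of_le_one_right' hg'
  have hd (t : ℝ) (ht : t ∈ Icc (0 : ℝ) 1) : ‖d t‖ ≤ 1 := by
    rw [Real.norm_of_nonneg Metric.infDist_nonneg]
    exact (Metric.infDist_le_dist_of_mem (mem_range_self ⟨0, Nat.pos_of_ne_zero hn⟩)).trans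
      (Real.dist_le_of_mem_Icc_01 ht (x _).2)
  calc ENNReal.ofReal (1 / (16 * n))
      = ‖(2⁻¹ : ℝ)‖ₑ * ENNReal.ofReal (1 / (8 * n)) := by
        rw [Real.enorm_of_nonneg (by norm_num), ← ENNReal.ofReal_mul (by norm_num)]
        congr 1
        field_simp
        norm_num
    _ ≤ ‖(2⁻¹ : ℝ)‖ₑ * eLpNorm d 1 lebesgue01 := by
        simp_rw [eLpNorm_one_eq_lintegral_enorm, d, Real.enorm_of_nonneg Metric.infDist_nonneg]
        exact mul_le_mul_right (inv_le_lintegral_infDist hn x) _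
    _ ≤ ‖(2⁻¹ : ℝ)‖ₑ * eLpNorm d q lebesgue01 := mul_le_mul_right
        (eLpNorm_le_eLpNorm_of_exponent_le hq hlip.continuous.aestronglyMeasurable) _
    _ ≤ radius p q x :=
        enorm_mul_eLpNorm_le_radius hp hq hlip (fun i => Metric.infDist_zero_of_mem ⟨i, rfl⟩)
          (hscale hd) (hscale fun t _ => norm_deriv_le_of_lipschitz hlip)

lemma optimalRadius_le_expectedRadius (p q : ℝ≥0∞) (n : ℕ) :
    optimalRadius p q n ≤ expectedRadius p q n := by
  calc optimalRadius p q n = ∫⁻ _ : Fin n → unitInterval, optimalRadius p q n := by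
        rw [lintegral_const, measure_univ, mul_one]
    _ ≤ expectedRadius p q n := lintegral_mono fun x => iInf_le _ x

end LowerBounds

section Asymp

variable {n₀ : ℕ} {a b c : ℕ → ℝ≥0∞}

lemma asymp_of_le_mul {C C' : ℝ≥0∞} (hC : C ≠ ⊤) (hC' : C' ≠ ⊤)
    (hab : ∀ n, n₀ ≤ n → a n ≤ C * b n) (hba : ∀ n, n₀ ≤ n → b n ≤ C' * a n) : Asymp n₀ a b := by
  lift C to ℝ≥0 using hC
  lift C' to ℝ≥0 using hC'
  refine ⟨max 1 (max C C'), by positivity, fun n hn => ⟨(hab n hn).trans ?_, (hba n hn).trans ?_⟩⟩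
  · gcongr
    exact le_max_of_le_right (le_max_left C C')
  · gcongr
    exact le_max_of_le_right (le_max_right C C')

lemma Asymp.symm (h : Asymp n₀ a b) : Asymp n₀ b a := by
  obtain ⟨C, hC, h⟩ := h
  exact ⟨C, hC, fun n hn => (h n hn).symm⟩

lemma Asymp.trans (hab : Asymp n₀ a b) (hbc : Asymp n₀ b c) : Asymp n₀ a c := by
  obtain ⟨C, -, hab⟩ := hab
  obtain ⟨D, -, hbc⟩ := hbc
  refine asymp_of_le_mul (C := C * D) (C' := D * C) (by finiteness) (by finiteness)
    (fun n hn => ?_) fun n hn => ?_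
  · rw [mul_assoc]
    exact (hab n hn).1.trans (mul_le_mul_right (hbc n hn).1 _)
  · rw [mul_assoc]
    exact (hbc n hn).2.trans (mul_le_mul_right (hab n hn).2 _)

end Asymp

section Scale

variable {n m : ℕ} {β K y z : ℝ}

lemma rpow_le_mul_rpow_neg (hβ : β ∈ Icc 0 1) (hK : 1 ≤ K) (hy : 0 < y) (hz0 : 0 ≤ z)
    (hz : z ≤ K / y) : z ^ β ≤ K * y ^ (-β) := by
  calc z ^ β ≤ (K / y) ^ β := Real.rpow_le_rpow hz0 hz hβ.1
    _ = K ^ β * y ^ (-β) := by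
      rw [Real.div_rpow (zero_le_one.trans hK) hy.le, Real.rpow_neg hy.le, div_eq_mul_inv]
    _ ≤ K * y ^ (-β) := by
      gcongr
      exact Real.rpow_le_self_of_one_le hK hβ.2

lemma rpow_neg_le_mul_rpow (hβ : β ∈ Icc 0 1) (hK : 1 ≤ K) (hy : 0 < y)
    (hz : 1 / (K * y) ≤ z) : y ^ (-β) ≤ K * z ^ β := by
  have hK0 : 0 < K := one_pos.trans_le hK
  calc y ^ (-β) = K ^ β * (1 / (K * y)) ^ β := by
        rw [← Real.mul_rpow hK0.le (by positivity), Real.rpow_neg_eq_inv_rpow]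
        congr 1
        field_simp
    _ ≤ K * z ^ β := by
        gcongr
        · exact Real.rpow_le_self_of_one_le hK hβ.2
        · exact hβ.1

lemma half_le_log (hn : 2 ≤ n) : 1 / 2 ≤ Real.log n := by
  have hmono : Real.log 2 ≤ Real.log n := Real.log_le_log two_pos (by exact_mod_cast hn)
  linarith [Real.log_two_gt_d9]

lemma two_le_div_log (hn : 2 ≤ n) : 2 ≤ (n : ℝ) / Real.log n := by
  have hlog := half_le_log hn
  have hn0 : (0 : ℝ) < n := by positivity
  have hhalf := Real.log_le_sub_one_of_pos (x := (n : ℝ) / 2) (by positivity)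
  rw [Real.log_div hn0.ne' two_ne_zero] at hhalf
  rw [le_div_iff₀ (by linarith)]
  linarith [Real.log_two_lt_d9]

lemma half_le_floor (hy : 1 ≤ y) : y / 2 ≤ ⌊y⌋₊ := by
  have hone : (1 : ℝ) ≤ ⌊y⌋₊ := by exact_mod_cast (Nat.one_le_floor_iff y).2 hy
  linarith [Nat.lt_floor_add_one y]

lemma exp_neg_two_mul_le (hy0 : 0 ≤ y) (hy : y ≤ 1 / 2) : Real.exp (-(2 * y)) ≤ 1 - y := by
  rw [Real.exp_neg, inv_le_comm₀ (Real.exp_pos _) (by linarith)]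
  calc (1 - y)⁻¹ ≤ 2 * y + 1 := by
        rw [inv_le_iff_one_le_mul₀ (by linarith)]
        nlinarith
    _ ≤ Real.exp (2 * y) := Real.add_one_le_exp _

lemma exp_neg_half_log (hy : 0 < y) : Real.exp (-(Real.log y / 2)) = (√y)⁻¹ := by
  rw [Real.exp_neg, ← Real.log_sqrt hy.le, Real.exp_log (Real.sqrt_pos.2 hy)]

lemma inv_sqrt_le_one_sub_pow (hn : n ≠ 0) (hm : 2 ≤ m) (hnm : 4 * (n : ℝ) ≤ m * Real.log n) :
    (√(n : ℝ))⁻¹ ≤ (1 - 1 / m) ^ n := by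
  have hm0 : (0 : ℝ) < m := by positivity
  have hquot : (n : ℝ) / m ≤ Real.log n / 4 := by
    rw [div_le_iff₀ hm0]
    linarith
  calc (√(n : ℝ))⁻¹ = Real.exp (-(Real.log n / 2)) := (exp_neg_half_log (by positivity)).symm
    _ ≤ Real.exp (n * (-(2 * (1 / m)))) := by
        refine Real.exp_le_exp.2 ?_
        linarith [mul_one_div (n : ℝ) m]
    _ = Real.exp (-(2 * (1 / m))) ^ n := Real.exp_nat_mul _ _
    _ ≤ (1 - 1 / m) ^ n := by
        gcongr
        exact exp_neg_two_mul_le (by positivity)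
          (one_div_le_one_div_of_le two_pos (by exact_mod_cast hm))

lemma log_le_two_mul_sqrt (hy : 0 ≤ y) : Real.log y ≤ 2 * √y := by
  have hlog := Real.log_le_self (Real.sqrt_nonneg y)
  rw [Real.log_sqrt hy] at hlog
  linarith

lemma one_le_mul_one_sub_pow (hn : 2 ≤ n) (hm : 4 * ((n : ℝ) / Real.log n) ≤ m) :
    1 ≤ (m : ℝ) * (1 - 1 / m) ^ n := by
  have hlog : 0 < Real.log n := one_half_pos.trans_le (half_le_log hn)
  have hm2 : 2 ≤ m := by
    have : (2 : ℝ) ≤ m := by linarith [two_le_div_log hn]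
    exact_mod_cast this
  have hsqrt0 : 0 < √(n : ℝ) := Real.sqrt_pos.2 (by positivity)
  have hsqrt : √(n : ℝ) ≤ m := by
    refine le_trans ?_ hm
    rw [← mul_div_assoc, le_div_iff₀ hlog]
    nlinarith [log_le_two_mul_sqrt n.cast_nonneg, Real.mul_self_sqrt (n.cast_nonneg (α := ℝ))]
  rw [← mul_div_assoc, div_le_iff₀ hlog] at hm
  calc (1 : ℝ) = √(n : ℝ) * (√(n : ℝ))⁻¹ := (mul_inv_cancel₀ hsqrt0.ne').symm
    _ ≤ m * (1 - 1 / m) ^ n := by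
        gcongr
        exact inv_sqrt_le_one_sub_pow (by positivity) hm2 hm

lemma mul_exp_neg_le (hn : 2 ≤ n) (hm0 : m ≠ 0) (hm : (m : ℝ) ≤ (n : ℝ) / Real.log n / 2) :
    m * Real.exp (-(n / m)) ≤ 2 / ((n : ℝ) / Real.log n) := by
  have hlog := half_le_log hn
  have hn0 : (0 : ℝ) < n := by positivity
  rw [div_div, le_div_iff₀ (by linarith)] at hm
  have hmn : (m : ℝ) ≤ n := by nlinarith [m.cast_nonneg (α := ℝ)]
  have hexp : Real.exp (-(n / m)) ≤ (n : ℝ)⁻¹ * (n : ℝ)⁻¹ := by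
    have hquot : Real.log n * 2 ≤ n / m := by
      rw [le_div_iff₀' (by positivity)]
      exact hm
    calc Real.exp (-(n / m)) ≤ Real.exp (-Real.log n + -Real.log n) :=
          Real.exp_le_exp.2 (by linarith)
      _ = (n : ℝ)⁻¹ * (n : ℝ)⁻¹ := by rw [Real.exp_add, Real.exp_neg, Real.exp_log hn0]
  calc m * Real.exp (-(n / m)) ≤ n * ((n : ℝ)⁻¹ * (n : ℝ)⁻¹) := by gcongr
    _ = 1 / n := by field_simp
    _ ≤ 2 * Real.log n / n := by
      gcongr
      linarith
    _ = 2 / ((n : ℝ) / Real.log n) := (div_div_eq_mul_div _ _ _).symm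

end Scale

section Rates

variable {p q : ℝ≥0∞} {n : ℕ} {y : ℝ}

lemma one_sub_toReal_inv_add_mem_Icc (hp : 1 ≤ p) (hpq : p ≤ q) :
    1 - p⁻¹.toReal + q⁻¹.toReal ∈ Icc (0 : ℝ) 1 := by
  have hinv : q⁻¹.toReal ≤ p⁻¹.toReal := ENNReal.toReal_mono
    (ENNReal.inv_ne_top.2 (one_pos.trans_le hp).ne') (ENNReal.inv_le_inv.2 hpq)
  exact ⟨add_nonneg (one_sub_toReal_inv_nonneg hp) ENNReal.toReal_nonneg, by linarith⟩

lemma optimalRadius_floor_le (hp : 1 ≤ p) (hpq : p ≤ q) (hy : 1 ≤ y) :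
    optimalRadius p q ⌊y⌋₊
      ≤ 8 * ENNReal.ofReal (y ^ (-(1 - p⁻¹.toReal + q⁻¹.toReal))) := by
  have hm := (Nat.floor_pos.2 hy).ne'
  have hm0 : (0 : ℝ) < ⌊y⌋₊ := by positivity
  have hfloor := half_le_floor hy
  have hβ := one_sub_toReal_inv_add_mem_Icc hp hpq
  have hscale := rpow_le_mul_rpow_neg (K := 4) (z := 2 * (1 / ⌊y⌋₊)) hβ (by norm_num)
    (by linarith) (by positivity) (by
      rw [mul_one_div, div_le_div_iff₀ hm0 (by linarith)]
      linarith)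
  calc optimalRadius p q ⌊y⌋₊
      ≤ ENNReal.ofReal (2 * (1 / ⌊y⌋₊)) ^ (1 - p⁻¹.toReal + q⁻¹.toReal) * 2 :=
        optimalRadius_le hp hpq hm
    _ ≤ ENNReal.ofReal (4 * y ^ (-(1 - p⁻¹.toReal + q⁻¹.toReal))) * 2 := by
        rw [ENNReal.ofReal_rpow_of_pos (by positivity)]
        gcongr
    _ = 8 * ENNReal.ofReal (y ^ (-(1 - p⁻¹.toReal + q⁻¹.toReal))) := by
        rw [ENNReal.ofReal_mul (by norm_num), ENNReal.ofReal_ofNat, mul_right_comm]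
        norm_num

lemma le_optimalRadius_floor (hp : 1 ≤ p) (hpq : p ≤ q) (hy : 1 ≤ y) :
    ENNReal.ofReal (y ^ (-(1 - p⁻¹.toReal + q⁻¹.toReal))) ≤ 32 * optimalRadius p q ⌊y⌋₊ := by
  have hscale := rpow_neg_le_mul_rpow (K := 4) (y := y)
    (z := 1 / (2 * ((⌊y⌋₊ + 1 : ℕ) : ℝ))) (one_sub_toReal_inv_add_mem_Icc hp hpq)
    (by norm_num) (by linarith) (by
      refine one_div_le_one_div_of_le (by positivity) ?_
      push_cast
      linarith [Nat.floor_le (zero_le_one.trans hy)])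
  calc ENNReal.ofReal (y ^ (-(1 - p⁻¹.toReal + q⁻¹.toReal)))
      ≤ ENNReal.ofReal
          (32 * ((1 / (2 * ((⌊y⌋₊ + 1 : ℕ) : ℝ))) ^ (1 - p⁻¹.toReal + q⁻¹.toReal) / 8)) :=
        ENNReal.ofReal_le_ofReal (by linarith)
    _ ≤ 32 * optimalRadius p q ⌊y⌋₊ := by
        rw [ENNReal.ofReal_mul (by norm_num), ENNReal.ofReal_ofNat]
        exact mul_le_mul_right (le_optimalRadius hp (hp.trans hpq) (Nat.lt_succ_self _)) _

lemma expectedRadius_le_rpow (hp : 1 ≤ p) (hpq : p ≤ q) (hn : 2 ≤ n) :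
    expectedRadius p q n
      ≤ 20 * ENNReal.ofReal (((n : ℝ) / Real.log n) ^ (-(1 - p⁻¹.toReal + q⁻¹.toReal))) := by
  set β := 1 - p⁻¹.toReal + q⁻¹.toReal
  set y : ℝ := (n : ℝ) / Real.log n
  set m := ⌊y / 2⌋₊
  have hy : 2 ≤ y := two_le_div_log hn
  have hβ : β ∈ Icc 0 1 := one_sub_toReal_inv_add_mem_Icc hp hpq
  have hm : m ≠ 0 := (Nat.floor_pos.2 (by linarith)).ne'
  have hm0 : (0 : ℝ) < m := by positivity
  have hfloor : y / 2 / 2 ≤ m := half_le_floor (by linarith)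
  have hmain : (2 * (1 / (m : ℝ))) ^ β ≤ 8 * y ^ (-β) := by
    refine rpow_le_mul_rpow_neg hβ (by norm_num) (by linarith) (by positivity) ?_
    rw [mul_one_div, div_le_div_iff₀ hm0 (by linarith)]
    linarith
  have htail : m * Real.exp (-(n / m)) ≤ 2 * y ^ (-β) := by
    refine (mul_exp_neg_le hn hm (Nat.floor_le (by linarith))).trans ?_
    rw [div_eq_mul_inv, ← Real.rpow_neg_one]
    gcongr
    · linarith
    · exact hβ.2
  calc expectedRadius p q n
      ≤ ENNReal.ofReal (2 * (1 / m)) ^ β * 2 + 2 * ENNReal.ofReal (m * Real.exp (-(n / m))) :=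
        expectedRadius_le hp hpq (by lia) hm
    _ ≤ ENNReal.ofReal (8 * y ^ (-β)) * 2 + 2 * ENNReal.ofReal (2 * y ^ (-β)) := by
        rw [ENNReal.ofReal_rpow_of_pos (by positivity)]
        gcongr
    _ = 20 * ENNReal.ofReal (y ^ (-β)) := by
        rw [ENNReal.ofReal_mul (by norm_num), ENNReal.ofReal_mul (by norm_num),
          ENNReal.ofReal_ofNat, ENNReal.ofReal_ofNat]
        ring

lemma rpow_le_expectedRadius (hp : 1 ≤ p) (hpq : p ≤ q) (hn : 2 ≤ n) :
    ENNReal.ofReal (((n : ℝ) / Real.log n) ^ (-(1 - p⁻¹.toReal + q⁻¹.toReal)))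
      ≤ 160 * expectedRadius p q n := by
  set β := 1 - p⁻¹.toReal + q⁻¹.toReal
  set y : ℝ := (n : ℝ) / Real.log n
  set m := ⌈4 * y⌉₊
  have hy : 2 ≤ y := two_le_div_log hn
  have hm : 4 * y ≤ m := Nat.le_ceil _
  have hm' : (m : ℝ) < 4 * y + 1 := Nat.ceil_lt_add_one (by linarith)
  have hscale : y ^ (-β) ≤ 10 * (1 / (2 * (m : ℝ))) ^ β :=
    rpow_neg_le_mul_rpow (one_sub_toReal_inv_add_mem_Icc hp hpq) (by norm_num) (by linarith)
      (one_div_le_one_div_of_le (by linarith) (by linarith))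
  calc ENNReal.ofReal (y ^ (-β))
      ≤ ENNReal.ofReal (160 * ((1 / (2 * m)) ^ β / 8 * (1 / 2))) :=
        ENNReal.ofReal_le_ofReal (by linarith)
    _ = 160 * (ENNReal.ofReal ((1 / (2 * m)) ^ β / 8) * (1 / 2)) := by
        rw [ENNReal.ofReal_mul (by norm_num), ENNReal.ofReal_mul (by positivity),
          ENNReal.ofReal_ofNat, ENNReal.ofReal_div_of_pos two_pos, ENNReal.ofReal_one,
          ENNReal.ofReal_ofNat]
    _ ≤ 160 * expectedRadius p q n :=
        mul_le_mul_right (le_expectedRadius hp (hp.trans hpq) (one_le_mul_one_sub_pow hn hm)) _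

lemma asymp_expectedRadius (hp : 1 ≤ p) (hpq : p ≤ q) :
    Asymp 2 (expectedRadius p q) fun n => ENNReal.ofReal
      (((n : ℝ) / Real.log n) ^ (-(1 - p⁻¹.toReal + q⁻¹.toReal))) :=
  asymp_of_le_mul (by finiteness) (by finiteness)
    (fun _ => expectedRadius_le_rpow hp hpq) fun _ => rpow_le_expectedRadius hp hpq

lemma asymp_optimalRadius_floor (hp : 1 ≤ p) (hpq : p ≤ q) :
    Asymp 2 (fun n => optimalRadius p q ⌊(n : ℝ) / Real.log n⌋₊) fun n => ENNReal.ofReal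
      (((n : ℝ) / Real.log n) ^ (-(1 - p⁻¹.toReal + q⁻¹.toReal))) := by
  have hone {n : ℕ} (hn : 2 ≤ n) : 1 ≤ (n : ℝ) / Real.log n :=
    one_le_two.trans (two_le_div_log hn)
  exact asymp_of_le_mul (by finiteness) (by finiteness)
    (fun n hn => optimalRadius_floor_le hp hpq (hone hn))
    fun n hn => le_optimalRadius_floor hp hpq (hone hn)

lemma asymp_inv_of_le_of_le (hp : 1 ≤ p) (hq : 1 ≤ q) (hqp : q < p) {a : ℕ → ℝ≥0∞}
    (hopt : optimalRadius p q ≤ a) (hexp : a ≤ expectedRadius p q) :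
    Asymp 1 a fun n => ENNReal.ofReal ((n : ℝ) ^ (-1 : ℝ)) := by
  have hinv {n : ℕ} (hn : 1 ≤ n) : ENNReal.ofReal ((n : ℝ) ^ (-1 : ℝ)) = (n : ℝ≥0∞)⁻¹ := by
    rw [Real.rpow_neg_one, ENNReal.ofReal_inv_of_pos (by positivity), ENNReal.ofReal_natCast]
  obtain ⟨C, hC, hle⟩ := exists_expectedRadius_le_mul_inv hq hqp
  refine asymp_of_le_mul (C' := 16) hC (by finiteness) (fun n hn => ?_) fun n hn => ?_
  · rw [hinv hn]
    exact (hexp n).trans (hle n (by lia))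
  · calc ENNReal.ofReal ((n : ℝ) ^ (-1 : ℝ)) = 16 * ENNReal.ofReal (1 / (16 * n)) := by
          rw [← ENNReal.ofReal_ofNat 16, ← ENNReal.ofReal_mul (by norm_num), Real.rpow_neg_one]
          congr 1
          field_simp
      _ ≤ 16 * a n := mul_le_mul_right
          ((inv_le_optimalRadius hp hq (by lia)).trans (hopt n)) _

end Rates

end RandomInfo

theorem mainTheorem2 (p q : ℝ≥0∞) (hp : 1 ≤ p) (hq : 1 ≤ q) :
    (∀ n : ℕ, AEMeasurable (fun x : Fin n → unitInterval => RandomInfo.radius p q x) volume) ∧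
    (q < p →
      RandomInfo.Asymp 1 (RandomInfo.expectedRadius p q) (RandomInfo.optimalRadius p q) ∧
      RandomInfo.Asymp 1 (RandomInfo.optimalRadius p q)
        (fun n => ENNReal.ofReal ((n : ℝ) ^ (-1 : ℝ)))) ∧
    (p ≤ q →
      RandomInfo.Asymp 2 (RandomInfo.expectedRadius p q)
        (fun n => RandomInfo.optimalRadius p q ⌊(n : ℝ) / Real.log n⌋₊) ∧
      RandomInfo.Asymp 2 (fun n => RandomInfo.optimalRadius p q ⌊(n : ℝ) / Real.log n⌋₊)
        (fun n => ENNReal.ofReal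
          (((n : ℝ) / Real.log n) ^ (-1 + p⁻¹.toReal - q⁻¹.toReal)))) := by
  refine ⟨RandomInfo.aemeasurable_radius hp hq, fun hqp => ?_, fun hpq => ?_⟩
  · have hle := RandomInfo.optimalRadius_le_expectedRadius p q
    have hexpected := RandomInfo.asymp_inv_of_le_of_le hp hq hqp hle le_rfl
    have hoptimal := RandomInfo.asymp_inv_of_le_of_le hp hq hqp le_rfl hle
    exact ⟨hexpected.trans hoptimal.symm, hoptimal⟩
  · have hexponent : -1 + p⁻¹.toReal - q⁻¹.toReal = -(1 - p⁻¹.toReal + q⁻¹.toReal) := by ring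
    have hexpected := RandomInfo.asymp_expectedRadius hp hpq
    have hoptimal := RandomInfo.asymp_optimalRadius_floor hp hpq
    rw [hexponent]
    exact ⟨hexpected.trans hoptimal.symm, hoptimal⟩
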